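/- Let $F,G$ be vector fields on $\mathbb{R}^n$, smooth in a neighborhood of $0$, with $F(0)=0$ and $G(0)\neq 0$, and consider the single-input system $\dot\xi=F(\xi)+G(\xi)u$. All notions are local, i.e. considered in sufficiently small neighborhoods of $0$; say that a property holds *generically* if it holds on an open set whose closure is a neighborhood of $0$. A system $\dot x=f(x)+g(x)v$, with $f,g$ smooth near $0$, is in *lower triangular form* if, near $0$, $f_i$ depends only on $x_1,\dots,x_{i+1}$ for $i\le n-1$, $g=(0,\dots,0,g_n)$ with $g_n(0)\ne0$, and for each $j\le n-1$ the derivative $\partial f_j/\partial x_{j+1}$ is generically nonzero (that is, it does not vanish identically on any nonempty open subset of some neighborhood of $0$). The system $\dot\xi=F+Gu$ is *locally equivalent to a lower triangular form* if it is transformed into one near $0$ by a feedback $u=\alpha(\xi)+\beta(\xi)v$ with $\alpha,\beta$ smooth near $0$ and $\beta(0)\neq0$, together with a change of coordinates $x=T(\xi)$, where $T$ is a local diffeomorphism with $T(0)=0$. Put $D^{n+1}=\{0\}$ and $D^n=\hat D^n=\mathrm{span}\{G\}$, and consider for $i=n-1,\dots,1$ the following step. Suppose that $D^{k}$ ($k=n+1,\dots,i+1$)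 and $\hat D^{l}$ ($l=n,\dots,i+1$) have already been defined by the previous steps. Take a vector field $G^{i+1}\in D^{i+1}\setminus D^{i+2}$, meaning that $G^{i+1}$ is smooth near $0$, $G^{i+1}(\xi)\in D^{i+1}(\xi)$ for $\xi$ near $0$, and generically $G^{i+1}(\xi)\notin D^{i+2}(\xi)$. Set $\hat D^i=\mathrm{span}\{\mathrm{ad}_{G^{i+1}}F,\hat D^{i+1}\}$, where $\mathrm{ad}_XY=[X,Y]$. The step can be carried out if there exists a smooth $(n-i+1)$-dimensional involutive distribution $D^i$ in a neighborhood of $0$ with $D^i=\hat D^i$ on an open subset of $\mathbb{R}^n$ whose closure is a neighborhood of $0$. Then the following are equivalent: 1. the system is locally equivalent to a lower triangular form; 2. for every $i=n-1,\dots,1$, for every outcome of the previous steps and for every vector field $G^{i+1}\in D^{i+1}\setminus D^{i+2}$, step $i$ can be carried out; 3. for some choices of the vector fields $G^{i+1}\in D^{i+1}\setminus D^{i+2}$ and the distributions $D^i$, all the steps $i=n-1,\dots,1$ can be carried out. -/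

import Mathlib

open Filter Topology
open scoped ContDiff

namespace TriForm

/-- The state space `ℝⁿ`. -/
abbrev E (n : ℕ) : Type := Fin n → ℝ

/-- A map is smooth in a neighbourhood of the origin. -/
def SmoothNear {n : ℕ} {W : Type*} [NormedAddCommGroup W] [NormedSpace ℝ W]
    (h : E n → W) : Prop :=
  ∀ᶠ x in 𝓝 (0 : E n), ContDiffAt ℝ ∞ h x

/-- `P` holds on an open set whose closure is a neighbourhood of the origin. -/
def DenselyNear {n : ℕ} (P : E n → Prop) : Prop :=
  ∃ O : Set (E n), IsOpen O ∧ closure O ∈ 𝓝 (0 : E n) ∧ ∀ x ∈ O, P x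

/-- The system `ẋ = f x + g x * v` is in lower triangular form near the origin: near `0`, `f i`
depends only on the coordinates up to the one following `i`, the derivative of `f j` with respect
to the next coordinate is not identically zero on any nonempty open subset of a neighbourhood of
`0`, and `g` has only its last component, which does not vanish at `0`. -/
structure IsLowerTriangular {n : ℕ} (f g : E n → E n) : Prop where
  smooth_f : SmoothNear f
  smooth_g : SmoothNear g
  triangular : ∃ U ∈ 𝓝 (0 : E n), ∀ x ∈ U, ∀ y ∈ U, ∀ i : Fin n,
    (∀ j : Fin n, (j : ℕ) ≤ (i : ℕ) + 1 → x j = y j) → f x i = f y i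
  partial_ne : ∀ j k : Fin n, (k : ℕ) = (j : ℕ) + 1 →
    DenselyNear fun x => fderiv ℝ (fun y => f y j) x (Pi.single k 1) ≠ 0
  input_zero : ∀ᶠ x in 𝓝 (0 : E n), ∀ i : Fin n, (i : ℕ) + 1 < n → g x i = 0
  input_last : ∀ i : Fin n, (i : ℕ) + 1 = n → g 0 i ≠ 0

/-- `ξ' = F ξ + G ξ * u` becomes a lower triangular form near the origin after a smooth feedback
`u = α ξ + β ξ * v`, `β 0 ≠ 0`, and a smooth local change of coordinates `x = T ξ`, `T 0 = 0`,
with smooth local inverse `S`. -/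
def LocallyEquivalentToTriangular {n : ℕ} (F G : E n → E n) : Prop :=
  ∃ (α β : E n → ℝ) (T S : E n → E n) (f g : E n → E n),
    SmoothNear α ∧ SmoothNear β ∧ β 0 ≠ 0 ∧
    SmoothNear T ∧ SmoothNear S ∧ T 0 = 0 ∧
    (∀ᶠ ξ in 𝓝 (0 : E n), S (T ξ) = ξ) ∧ (∀ᶠ x in 𝓝 (0 : E n), T (S x) = x) ∧
    IsLowerTriangular f g ∧
    (∀ᶠ ξ in 𝓝 (0 : E n), fderiv ℝ T ξ (F ξ + α ξ • G ξ) = f (T ξ)) ∧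
    (∀ᶠ ξ in 𝓝 (0 : E n), fderiv ℝ T ξ (β ξ • G ξ) = g (T ξ))

/-- `X` is a smooth section of `D` in a neighbourhood of the origin. -/
def IsSection {n : ℕ} (D : E n → Submodule ℝ (E n)) (X : E n → E n) : Prop :=
  SmoothNear X ∧ ∀ᶠ x in 𝓝 (0 : E n), X x ∈ D x

/-- `D` is a smooth `d`-dimensional involutive distribution in a neighbourhood of the origin. -/
structure IsInvolutiveDistribution {n : ℕ} (d : ℕ) (D : E n → Submodule ℝ (E n)) : Prop where
  frame : ∃ X : Fin d → E n → E n, (∀ a, SmoothNear (X a)) ∧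
    ∀ᶠ x in 𝓝 (0 : E n), LinearIndependent ℝ (fun a => X a x) ∧
      D x = Submodule.span ℝ (Set.range fun a => X a x)
  involutive : ∀ X Y : E n → E n, IsSection D X → IsSection D Y →
    ∀ᶠ x in 𝓝 (0 : E n), VectorField.lieBracket ℝ X Y x ∈ D x

/-- The vector field `X` lies in `D \ D'`: it is a smooth section of `D` near the origin, and its
values lie outside `D'` on an open set whose closure is a neighbourhood of the origin. -/
def IsChoice {n : ℕ} (D D' : E n → Submodule ℝ (E n)) (X : E n → E n) : Prop :=
  IsSection D X ∧ DenselyNear fun x => X x ∉ D' x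

/-- The distribution `span {ad_X F, D}`, where `ad_X F = [X, F]`. -/
def adSpan {n : ℕ} (F X : E n → E n) (D : E n → Submodule ℝ (E n)) :
    E n → Submodule ℝ (E n) :=
  fun x => Submodule.span ℝ {VectorField.lieBracket ℝ X F x} ⊔ D x

/-- The data `D k` (`i ≤ k ≤ n + 1`), `Dhat k` (`i ≤ k ≤ n`) and `H k`
(`i + 1 ≤ k ≤ n`; the vector fields called `Gᵏ`) have been obtained by carrying out the steps
`n - 1, …, i` of the construction for the system with drift `F` and input vector field `G`. -/
structure IsChain {n : ℕ} (F G : E n → E n) (i : ℕ)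
    (D Dhat : ℕ → E n → Submodule ℝ (E n)) (H : ℕ → E n → E n) : Prop where
  zero : ∀ x, D (n + 1) x = ⊥
  input : ∀ x, D n x = Submodule.span ℝ {G x}
  input_hat : ∀ x, Dhat n x = Submodule.span ℝ {G x}
  choice : ∀ k, i ≤ k → k < n → IsChoice (D (k + 1)) (D (k + 2)) (H (k + 1))
  hat : ∀ k, i ≤ k → k < n → Dhat k = adSpan F (H (k + 1)) (Dhat (k + 1))
  distribution : ∀ k, i ≤ k → k < n → IsInvolutiveDistribution (n - k + 1) (D k)
  agree : ∀ k, i ≤ k → k < n → DenselyNear fun x => D k x = Dhat k x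

/-- Every step of the construction can be carried out, whatever choices were made before and
whatever vector field is taken in `D (i + 1) \ D (i + 2)`. -/
def ConditionForAllChoices {n : ℕ} (F G : E n → E n) : Prop :=
  ∀ i : ℕ, 1 ≤ i → i < n → ∀ (D Dhat : ℕ → E n → Submodule ℝ (E n)) (H : ℕ → E n → E n),
    IsChain F G (i + 1) D Dhat H → ∀ X : E n → E n, IsChoice (D (i + 1)) (D (i + 2)) X →
      ∃ D' : E n → Submodule ℝ (E n), IsInvolutiveDistribution (n - i + 1) D' ∧
        DenselyNear fun x => D' x = adSpan F X (Dhat (i + 1)) x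

/-- All the steps `n - 1, …, 1` of the construction can be carried out for some choices. -/
def ConditionForSomeChoices {n : ℕ} (F G : E n → E n) : Prop :=
  ∃ (D Dhat : ℕ → E n → Submodule ℝ (E n)) (H : ℕ → E n → E n), IsChain F G 1 D Dhat H

end TriForm

/-!
The proof runs (1) ⇒ (2) ⇒ (3) ⇒ (1).

Everything is expressed through the flag `coordFlag T` of a chart `T`, whose `k`-th member is
the common kernel of the differentials of the first `k - 1` coordinates, and through the formula
`dφ [X, Y] = X (dφ Y) - Y (dφ X)` applied to the coordinates `φ` of `T`.  Two distributions of
constant rank which agree on a dense open set agree, since membership of a field is an equation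
between continuous functions (`IsAdapted.mem_of_densely`).

(1) ⇒ (2).  If the system is triangular in the chart `T`, then the bracket of the drift with a
field whose leading component is the `(k + 1)`-st has its leading component in position `k`, equal
to the product of that component with `∂f_k/∂x_{k+1}`, which is densely nonzero
(`IsChart.adSpan_coordFlag`).  So whatever choices are made, the distributions produced by the
construction are the members of the coordinate flag, and these allow the next step.

(2) ⇒ (3).  A field in `D^{i+1}` outside `D^{i+2}` exists because the ranks differ.

(3) ⇒ (1).  The distributions of a full chain form a flag of involutive distributions with ranks
`1, …, n`.  By the theorem of Frobenius (`exists_first_integrals`) each of them is cut out in the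
next larger one by one function, and these functions are the coordinates of a chart `T` whose
coordinate flag is the given one (`IsChain.exists_isChart`).  The chosen fields span the flag
densely, and their brackets with the drift move the index of the leading component down by exactly
one; this is the triangular form of the drift (`IsChain.fderiv_drift_eq_zero`).

The theorem of Frobenius is obtained from the inverse function theorem on the Banach space of
continuous curves: one flows from a point `z` along the commuting fields of a frame, inside its
leaf, to a fixed transversal; the endpoint depends smoothly on `z` and its derivative vanishes
along the distribution.
-/

namespace TriForm

/-! ### Properties holding densely near the origin -/

section Densely

variable {n : ℕ}

/-- The form in which density is used: a dense open set near `0` becomes a statement about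
neighbourhood filters. -/
theorem denselyNear_iff {P : E n → Prop} :
    DenselyNear P ↔ ∀ᶠ x in 𝓝 (0 : E n), ∃ᶠ y in 𝓝 x, ∀ᶠ w in 𝓝 y, P w := by
  constructor
  · rintro ⟨O, hO, hcl, hP⟩
    filter_upwards [hcl] with x hx
    exact (mem_closure_iff_frequently.1 hx).mono fun y hy =>
      mem_of_superset (hO.mem_nhds hy) hP
  · intro h
    refine ⟨interior {x | P x}, isOpen_interior, ?_, fun x hx => interior_subset hx⟩
    filter_upwards [h] with x hx
    exact mem_closure_iff_frequently.2 (hx.mono fun y hy => mem_interior_iff_mem_nhds.2 hy)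

theorem DenselyNear.of_eventually {P : E n → Prop} (h : ∀ᶠ x in 𝓝 (0 : E n), P x) :
    DenselyNear P :=
  denselyNear_iff.2 (h.eventually_nhds.mono fun _ hx => hx.eventually_nhds.frequently)

theorem DenselyNear.and {P Q : E n → Prop} (hP : DenselyNear P) (hQ : DenselyNear Q) :
    DenselyNear fun x => P x ∧ Q x := by
  rw [denselyNear_iff] at *
  filter_upwards [hP, hQ.eventually_nhds] with x hx hx'
  -- a point where `P` holds locally is a limit of points where `Q` holds locally as well
  refine frequently_frequently_nhds.1 ((hx.and_eventually hx').mono fun y hy => ?_)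
  refine (hy.2.and_eventually hy.1.eventually_nhds).mono fun z hz => ?_
  filter_upwards [hz.1, hz.2] with w h1 h2 using ⟨h2, h1⟩

theorem DenselyNear.mono_eventually {P Q : E n → Prop} (hP : DenselyNear P)
    (h : ∀ᶠ x in 𝓝 (0 : E n), P x → Q x) : DenselyNear Q := by
  rw [denselyNear_iff] at *
  filter_upwards [hP, h.eventually_nhds] with x hx hx'
  refine (hx.and_eventually hx'.eventually_nhds).mono fun y hy => ?_
  filter_upwards [hy.1, hy.2] with w h1 h2 using h2 h1

theorem DenselyNear.mono {P Q : E n → Prop} (hP : DenselyNear P)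
    (h : ∀ x, P x → Q x) : DenselyNear Q :=
  hP.mono_eventually (Eventually.of_forall h)

/-- A property that holds densely passes to preimages under local homeomorphisms. -/
theorem DenselyNear.comp {P : E n → Prop} (hP : DenselyNear P) {S T : E n → E n} (hS0 : S 0 = 0)
    (hS : ∀ᶠ x in 𝓝 (0 : E n), ContinuousAt S x) (hT : ∀ᶠ x in 𝓝 (0 : E n), ContinuousAt T x)
    (hST : ∀ᶠ x in 𝓝 (0 : E n), S (T x) = x) (hTS : ∀ᶠ x in 𝓝 (0 : E n), T (S x) = x) :
    DenselyNear fun x => P (S x) := by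
  rw [denselyNear_iff] at *
  have hS' : Tendsto S (𝓝 0) (𝓝 0) := by
    have := hS.self_of_nhds.tendsto
    rwa [hS0] at this
  filter_upwards [hTS, hS'.eventually hP, hS'.eventually hT, hS'.eventually hST.eventually_nhds,
    hS.eventually_nhds] with x h1 h2 h3 h4 h5
  have hTx : Tendsto T (𝓝 (S x)) (𝓝 x) := by
    have := h3.tendsto
    rwa [h1] at this
  refine hTx.frequently ((h2.and_eventually (h4.and (hTx.eventually h5))).mono
    fun y ⟨h6, h7, h8⟩ => ?_)
  have h9 := h8.tendsto
  rw [h7] at h9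
  exact h9.eventually h6

/-- Two functions which are continuous near the origin and agree densely agree near the origin. -/
theorem DenselyNear.eventuallyEq {W : Type*} [TopologicalSpace W] [T2Space W] {a b : E n → W}
    (h : DenselyNear fun x => a x = b x) (ha : ∀ᶠ x in 𝓝 (0 : E n), ContinuousAt a x)
    (hb : ∀ᶠ x in 𝓝 (0 : E n), ContinuousAt b x) : ∀ᶠ x in 𝓝 (0 : E n), a x = b x := by
  rw [denselyNear_iff] at h
  filter_upwards [h, ha, hb] with x hx hax hbx
  by_contra hne
  have : ∀ᶠ y in 𝓝 x, a y ≠ b y := by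
    exact hax.ne_iff_eventually_ne hbx |>.1 hne
  obtain ⟨y, hy, hy'⟩ := (hx.and_eventually this).exists
  exact hy' hy.self_of_nhds

end Densely

/-! ### Maps that are smooth near the origin -/

section Smooth

variable {n : ℕ} {W V : Type*} [NormedAddCommGroup W] [NormedSpace ℝ W]
  [NormedAddCommGroup V] [NormedSpace ℝ V]

theorem SmoothNear.differentiableAt {h : E n → W} (hh : SmoothNear h) :
    ∀ᶠ x in 𝓝 (0 : E n), DifferentiableAt ℝ h x :=
  hh.mono fun _ hx => hx.differentiableAt (by simp)

theorem SmoothNear.continuousAt {h : E n → W} (hh : SmoothNear h) :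
    ∀ᶠ x in 𝓝 (0 : E n), ContinuousAt h x :=
  hh.mono fun _ hx => hx.continuousAt

theorem SmoothNear.fderiv {h : E n → W} (hh : SmoothNear h) : SmoothNear (fderiv ℝ h) :=
  hh.mono fun _ hx => hx.fderiv_right (m := ∞) (by simp)

theorem SmoothNear.clm_apply {h : E n → V →L[ℝ] W} {k : E n → V} (hh : SmoothNear h)
    (hk : SmoothNear k) : SmoothNear fun x => h x (k x) := by
  filter_upwards [hh, hk] with x h1 h2 using h1.clm_apply h2

theorem SmoothNear.tendsto {h : E n → W} (hh : SmoothNear h) (h0 : h 0 = 0) :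
    Tendsto h (𝓝 0) (𝓝 0) := by
  simpa [h0] using hh.self_of_nhds.continuousAt.tendsto

theorem SmoothNear.comp {m : ℕ} {h : E m → W} {T : E n → E m} (hh : SmoothNear h)
    (hT : SmoothNear T) (h0 : T 0 = 0) : SmoothNear fun x => h (T x) := by
  filter_upwards [hT, (hT.tendsto h0).eventually hh] with x h1 h2 using h2.comp x h1

theorem SmoothNear.const (w : W) : SmoothNear fun _ : E n => w :=
  Eventually.of_forall fun _ => contDiffAt_const

/-- The differential of `φ` evaluated on a bracket is the commutator of the derivatives along the
two fields.  All brackets are computed through this formula, so that no vector field has to be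
transported by a change of coordinates. -/
theorem SmoothNear.fderiv_lieBracket {φ : E n → W} {X Y : E n → E n} (hφ : SmoothNear φ)
    (hX : SmoothNear X) (hY : SmoothNear Y) :
    ∀ᶠ x in 𝓝 (0 : E n), _root_.fderiv ℝ φ x (VectorField.lieBracket ℝ X Y x) =
      _root_.fderiv ℝ (fun y => _root_.fderiv ℝ φ y (Y y)) x (X x) -
        _root_.fderiv ℝ (fun y => _root_.fderiv ℝ φ y (X y)) x (Y x) := by
  filter_upwards [hφ, hX.differentiableAt, hY.differentiableAt] with x h1 h2 h3
  have h4 : ((2 : ℕ∞) : WithTop ℕ∞) ≤ ((⊤ : ℕ∞) : WithTop ℕ∞) := WithTop.coe_le_coe.2 le_top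
  refine VectorField.fderiv_apply_lieBracket h1 ?_ h3 h2
  rw [minSmoothness_of_isRCLikeNormedField]
  exact h4

theorem map_eq_sum_single (L : E n →L[ℝ] W) (v : E n) :
    L v = ∑ j, v j • L (Pi.single j 1) := by
  conv_lhs => rw [pi_eq_sum_univ' v, map_sum]
  simp only [map_smul]

theorem fderiv_eq_zero_of_eventually {h : E n → W} (hh : ∀ᶠ x in 𝓝 (0 : E n), h x = 0) :
    ∀ᶠ x in 𝓝 (0 : E n), fderiv ℝ h x = 0 := by
  filter_upwards [hh.eventually_nhds] with x hx
  have : h =ᶠ[𝓝 x] fun _ => 0 := hx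
  rw [this.fderiv_eq]
  simp

end Smooth

/-! ### Distributions as ranges of adapted frames -/

section Frames

variable {n d : ℕ}

/-- Near the origin the distribution `D` is the range of the injective maps `K x`, normalised by
a fixed linear map `π` so that `π ∘ K x` is the identity: the fields `x ↦ K x c` form a frame of
`D` whose components under `π` are constant. -/
structure IsAdapted (D : E n → Submodule ℝ (E n)) (π : E n →L[ℝ] (Fin d → ℝ))
    (K : E n → (Fin d → ℝ) →L[ℝ] E n) : Prop where
  smooth : SmoothNear K
  proj : ∀ᶠ x in 𝓝 (0 : E n), ∀ c, π (K x c) = c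
  mem_iff : ∀ᶠ x in 𝓝 (0 : E n), ∀ v, v ∈ D x ↔ K x (π v) = v

/-- Every distribution with a smooth frame `X` has an adapted frame: with `L x` the map sending
the standard basis to the frame and `π` a left inverse of `L 0`, take
`K x = L x ∘ (π ∘ L x)⁻¹`. -/
theorem exists_isAdapted {D : E n → Submodule ℝ (E n)}
    (hD : ∃ X : Fin d → E n → E n, (∀ a, SmoothNear (X a)) ∧
      ∀ᶠ x in 𝓝 (0 : E n), LinearIndependent ℝ (fun a => X a x) ∧
        D x = Submodule.span ℝ (Set.range fun a => X a x)) :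
    ∃ (π : E n →L[ℝ] (Fin d → ℝ)) (K : E n → (Fin d → ℝ) →L[ℝ] E n), IsAdapted D π K := by
  obtain ⟨X, hX, hXD⟩ := hD
  let L : E n → (Fin d → ℝ) →L[ℝ] E n := fun x =>
    ∑ a, (ContinuousLinearMap.proj (R := ℝ) (φ := fun _ : Fin d => ℝ) a).smulRight (X a x)
  have hLapp : ∀ x c, L x c = ∑ a, c a • X a x := fun x c => by
    simp [L]
  have hL : SmoothNear L := by
    filter_upwards [eventually_all.2 hX] with x hx
    exact ContDiffAt.sum fun a _ => contDiffAt_const.smulRight (hx a)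
  have hinj : Function.Injective (L 0 : (Fin d → ℝ) →ₗ[ℝ] E n) := by
    have := linearIndependent_iff_injective_fintypeLinearCombination.1 hXD.self_of_nhds.1
    intro c c' h
    refine this ?_
    simpa [hLapp, Fintype.linearCombination_apply] using h
  obtain ⟨p, hp⟩ := LinearMap.exists_leftInverse_of_injective _ (LinearMap.ker_eq_bot.2 hinj)
  let π : E n →L[ℝ] (Fin d → ℝ) := LinearMap.toContinuousLinearMap p
  let M : E n → (Fin d → ℝ) →L[ℝ] (Fin d → ℝ) := fun x => π ∘L L x
  have hM : SmoothNear M := by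
    filter_upwards [hL] with x hx using contDiffAt_const.clm_comp hx
  have hM0 : M 0 = 1 := by
    ext1 c
    exact LinearMap.congr_fun hp c
  have hunit : ∀ᶠ x in 𝓝 (0 : E n), IsUnit (M x) := by
    have : {A : (Fin d → ℝ) →L[ℝ] (Fin d → ℝ) | IsUnit A} ∈ 𝓝 (M 0) :=
      Units.isOpen.mem_nhds (by simp [hM0])
    exact hM.self_of_nhds.continuousAt.eventually this
  refine ⟨π, fun x => L x ∘L Ring.inverse (M x), ?_, ?_, ?_⟩
  · filter_upwards [hL, hM, hunit] with x h1 h2 ⟨u, hu⟩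
    refine h1.clm_comp (ContDiffAt.comp (g := Ring.inverse) x ?_ h2)
    rw [← hu]
    exact contDiffAt_ringInverse ℝ u
  · filter_upwards [hunit] with x hu c
    exact DFunLike.congr_fun (Ring.mul_inverse_cancel (M x) hu) c
  · filter_upwards [hunit, hXD] with x hu ⟨_, hx⟩ v
    rw [hx, ← Fintype.range_linearCombination]
    constructor
    · rintro ⟨c, rfl⟩
      have : Fintype.linearCombination ℝ (fun a => X a x) c = L x c := by
        simp [hLapp, Fintype.linearCombination_apply]
      rw [this]
      exact congrArg (L x) (DFunLike.congr_fun (Ring.inverse_mul_cancel (M x) hu) c)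
    · intro h
      rw [← h]
      exact ⟨Ring.inverse (M x) (π v), by simp [hLapp, Fintype.linearCombination_apply]⟩

variable {D : E n → Submodule ℝ (E n)} {π : E n →L[ℝ] (Fin d → ℝ)}
  {K : E n → (Fin d → ℝ) →L[ℝ] E n}

theorem IsAdapted.mem (h : IsAdapted D π K) :
    ∀ᶠ x in 𝓝 (0 : E n), ∀ c, K x c ∈ D x := by
  filter_upwards [h.proj, h.mem_iff] with x h1 h2 c
  rw [h2, h1]

theorem IsAdapted.isSection (h : IsAdapted D π K) (c : Fin d → ℝ) :
    IsSection D fun x => K x c :=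
  ⟨h.smooth.clm_apply (.const c), h.mem.mono fun _ hx => hx c⟩

theorem IsAdapted.finrank (h : IsAdapted D π K) :
    ∀ᶠ x in 𝓝 (0 : E n), Module.finrank ℝ (D x) = d := by
  filter_upwards [h.proj, h.mem_iff] with x h1 h2
  have hinj : Function.Injective (K x : (Fin d → ℝ) →ₗ[ℝ] E n) := fun c c' hc => by
    have := congrArg π hc
    simpa [h1] using this
  have : D x = LinearMap.range (K x : (Fin d → ℝ) →ₗ[ℝ] E n) := by
    ext v
    rw [h2]
    constructor
    · intro hv
      exact ⟨π v, hv⟩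
    · rintro ⟨c, rfl⟩
      exact congrArg (K x) (h1 c)
  rw [this, LinearMap.finrank_range_of_inj hinj]
  simp

/-- A distribution of constant rank is closed: a field lying densely in it lies in it. -/
theorem IsAdapted.mem_of_densely (h : IsAdapted D π K) {X : E n → E n} (hX : SmoothNear X)
    (hd : DenselyNear fun x => X x ∈ D x) : ∀ᶠ x in 𝓝 (0 : E n), X x ∈ D x := by
  have h1 : DenselyNear fun x => K x (π (X x)) = X x :=
    hd.mono_eventually (h.mem_iff.mono fun x hx => (hx _).1)
  have h2 : SmoothNear fun x => K x (π (X x)) :=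
    h.smooth.clm_apply (hX.mono fun x hx => π.contDiff.contDiffAt.comp x hx)
  filter_upwards [h1.eventuallyEq h2.continuousAt hX.continuousAt, h.mem_iff] with x h3 h4
  exact (h4 _).2 h3

/-- The inclusion of `D` in a family of subspaces may be checked on sections, one at a time: only
the finitely many sections of the frame matter, so the neighbourhoods can be made uniform. -/
theorem IsAdapted.le_of_sections (h : IsAdapted D π K) {A : E n → Submodule ℝ (E n)}
    (hA : ∀ X, IsSection D X → ∀ᶠ x in 𝓝 (0 : E n), X x ∈ A x) :
    ∀ᶠ x in 𝓝 (0 : E n), D x ≤ A x := by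
  have := eventually_all.2 fun a : Fin d => hA _ (h.isSection (Pi.single a 1))
  filter_upwards [this, h.mem_iff] with x h1 h2 v hv
  rw [← (h2 v).1 hv, map_eq_sum_single (K x)]
  exact (A x).sum_mem fun a _ => (A x).smul_mem _ (h1 a)

theorem IsAdapted.eventually_notMem (h : IsAdapted D π K) {X : E n → E n} (hX : SmoothNear X)
    (h0 : X 0 ∉ D 0) : ∀ᶠ x in 𝓝 (0 : E n), X x ∉ D x := by
  have h1 : SmoothNear fun x => K x (π (X x)) :=
    h.smooth.clm_apply (hX.mono fun x hx => π.contDiff.contDiffAt.comp x hx)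
  rw [h.mem_iff.self_of_nhds] at h0
  filter_upwards [h.mem_iff, (h1.self_of_nhds.continuousAt.ne_iff_eventually_ne
    hX.self_of_nhds.continuousAt).1 h0] with x h2 h3
  rwa [h2]

/-- Inclusion of distributions of constant rank may be checked densely. -/
theorem IsAdapted.le_of_densely {d' : ℕ} {D' : E n → Submodule ℝ (E n)}
    {π' : E n →L[ℝ] (Fin d' → ℝ)} {K' : E n → (Fin d' → ℝ) →L[ℝ] E n} (h : IsAdapted D π K)
    (h' : IsAdapted D' π' K') (hd : DenselyNear fun x => D x ≤ D' x) :
    ∀ᶠ x in 𝓝 (0 : E n), D x ≤ D' x := by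
  refine h.le_of_sections fun X hX => ?_
  exact h'.mem_of_densely hX.1 (hd.mono_eventually (hX.2.mono fun x hx hle => hle hx))

end Frames

/-! ### A smooth inverse function theorem in a neighbourhood -/

/-- Inverse function theorem in which the smoothness of the local inverse is stated at all points
of a neighbourhood: being `C^∞` at a single point would only give `C^m` on neighbourhoods
depending on `m`. -/
theorem exists_smooth_local_inverse {X Y : Type*} [NormedAddCommGroup X] [NormedSpace ℝ X]
    [CompleteSpace X] [NormedAddCommGroup Y] [NormedSpace ℝ Y] {f : X → Y} {a : X}
    (hf : ∀ᶠ x in 𝓝 a, ContDiffAt ℝ ∞ f x) (e : X ≃L[ℝ] Y) (he : fderiv ℝ f a = e) :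
    ∃ S : Y → X, (∀ᶠ y in 𝓝 (f a), ContDiffAt ℝ ∞ S y) ∧ S (f a) = a ∧
      (∀ᶠ x in 𝓝 a, S (f x) = x) ∧ (∀ᶠ y in 𝓝 (f a), f (S y) = y) := by
  have hfa := hf.self_of_nhds
  have hd : HasFDerivAt f (e : X →L[ℝ] Y) a := by
    rw [← he]
    exact (hfa.differentiableAt (by simp)).hasFDerivAt
  let p := hfa.toOpenPartialHomeomorph f hd (by simp)
  have hpa : a ∈ p.source := hfa.mem_toOpenPartialHomeomorph_source hd (by simp)
  have hpt : f a ∈ p.target := hfa.image_mem_toOpenPartialHomeomorph_target hd (by simp)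
  have hS : p.symm (f a) = a := p.left_inv hpa
  have hcont : Tendsto p.symm (𝓝 (f a)) (𝓝 a) := by
    have := (p.continuousAt_symm hpt).tendsto
    rwa [hS] at this
  have hinv : ∀ᶠ x in 𝓝 a, fderiv ℝ f x ∈ Set.range ((↑) : (X ≃L[ℝ] Y) → X →L[ℝ] Y) := by
    have h1 : ContinuousAt (fderiv ℝ f) a :=
      (hfa.fderiv_right (m := 0) (by simp)).continuousAt
    refine h1.eventually ?_
    rw [he]
    exact ContinuousLinearEquiv.nhds e
  refine ⟨p.symm, ?_, hS, ?_, ?_⟩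
  · filter_upwards [hcont.eventually hf, hcont.eventually hinv, p.open_target.mem_nhds hpt]
      with y h1 ⟨e', he'⟩ h3
    refine p.contDiffAt_symm (f₀' := e') h3 ?_ h1
    rw [he']
    exact (h1.differentiableAt (by simp)).hasFDerivAt
  · filter_upwards [p.open_source.mem_nhds hpa] with x hx using p.left_inv hx
  · filter_upwards [p.open_target.mem_nhds hpt] with y hy using p.right_inv hy

/-! ### Calculus in the Banach space of continuous curves -/

section Curves

open unitInterval

variable {A B : Type} [NormedAddCommGroup A] [NormedSpace ℝ A]
  [NormedAddCommGroup B] [NormedSpace ℝ B]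

/-- Pointwise application of a curve of linear maps to a curve of vectors. -/
noncomputable def curveApply : C(I, A →L[ℝ] B) →L[ℝ] C(I, A) →L[ℝ] C(I, B) :=
  LinearMap.mkContinuous₂
    (LinearMap.mk₂ ℝ (fun (M : C(I, A →L[ℝ] B)) (h : C(I, A)) =>
        (⟨fun t => M t (h t), M.continuous.clm_apply h.continuous⟩ : C(I, B)))
      (fun _ _ _ => by ext; simp) (fun _ _ _ => by ext; simp)
      (fun _ _ _ => by ext; simp) (fun _ _ _ => by ext; simp))
    1 (fun M h => by
      rw [one_mul]
      refine (ContinuousMap.norm_le _ (by positivity)).2 fun t => ?_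
      exact ((M t).le_opNorm _).trans
        (mul_le_mul (M.norm_coe_le_norm t) (h.norm_coe_le_norm t) (norm_nonneg _) (norm_nonneg M)))

@[simp] theorem curveApply_apply (M : C(I, A →L[ℝ] B)) (h : C(I, A)) (t : I) :
    curveApply M h t = M t (h t) := rfl

/-- The constant curves, as a continuous linear map. -/
noncomputable def curveConst : A →L[ℝ] C(I, A) :=
  LinearMap.mkContinuous
    { toFun := fun a => ContinuousMap.const I a
      map_add' := fun _ _ => rfl
      map_smul' := fun _ _ => rfl } 1 (fun a => by
      rw [one_mul]
      exact (ContinuousMap.norm_le _ (norm_nonneg _)).2 fun t => le_rfl)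

@[simp] theorem curveConst_apply (a : A) (t : I) : curveConst a t = a := rfl

/-- The primitive of a curve vanishing at time `0`, as a continuous linear map. -/
noncomputable def curvePrimitive [CompleteSpace A] : C(I, A) →L[ℝ] C(I, A) :=
  LinearMap.mkContinuous
    { toFun := fun b =>
        ⟨fun t => ∫ s in (0 : ℝ)..t, Set.IccExtend zero_le_one b s,
          (intervalIntegral.continuous_primitive
            (fun _ _ => (b.continuous.Icc_extend').intervalIntegrable _ _) 0).comp
              continuous_subtype_val⟩
      map_add' := fun b c => by
        ext t
        exact intervalIntegral.integral_add ((b.continuous.Icc_extend').intervalIntegrable _ _)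
          ((c.continuous.Icc_extend').intervalIntegrable _ _)
      map_smul' := fun r b => by
        ext t
        exact intervalIntegral.integral_smul _ _ } 1 (fun b => by
      rw [one_mul]
      refine (ContinuousMap.norm_le _ (norm_nonneg _)).2 fun t => ?_
      have := intervalIntegral.norm_integral_le_of_norm_le_const (a := (0 : ℝ)) (b := t)
        (f := Set.IccExtend zero_le_one b) (C := ‖b‖) fun s _ => b.norm_coe_le_norm _
      refine this.trans (mul_le_of_le_one_right (norm_nonneg _) ?_)
      rw [sub_zero, abs_of_nonneg t.2.1]
      exact t.2.2)

theorem curvePrimitive_apply [CompleteSpace A] (b : C(I, A)) (t : I) :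
    curvePrimitive b t = ∫ s in (0 : ℝ)..t, Set.IccExtend zero_le_one b s := rfl

/-- Substitution into a `C^1` map is differentiable on the space of continuous curves. -/
theorem hasFDerivAt_curve_comp {K : A → B} {K' : A → A →L[ℝ] B} (hK : ∀ x, HasFDerivAt K (K' x) x)
    (hKc : Continuous K) (hK' : Continuous K') (γ : C(I, A)) :
    HasFDerivAt (fun γ : C(I, A) => (⟨K, hKc⟩ : C(A, B)).comp γ)
      (curveApply ((⟨K', hK'⟩ : C(A, A →L[ℝ] B)).comp γ)) γ := by
  rw [hasFDerivAt_iff_isLittleO_nhds_zero, Asymptotics.isLittleO_iff]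
  intro ε hε
  have hcont := (ContinuousMap.continuous_postcomp (X := I) (⟨K', hK'⟩ : C(A, A →L[ℝ] B)))
  obtain ⟨δ, hδ, hball⟩ :=
    (Metric.continuous_iff (α := C(I, A)) (β := C(I, A →L[ℝ] B))).1 hcont γ ε hε
  filter_upwards [Metric.ball_mem_nhds (0 : C(I, A)) hδ] with h hh
  refine (ContinuousMap.norm_le _ (by positivity)).2 fun t => ?_
  have key : ‖K (γ t + h t) - K (γ t) - K' (γ t) (γ t + h t - γ t)‖ ≤ ε * ‖γ t + h t - γ t‖ := by
    refine (convex_ball (γ t) δ).norm_image_sub_le_of_norm_hasFDerivWithin_le'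
      (f' := K') (fun x _ => (hK x).hasFDerivWithinAt) (fun x hx => ?_)
      (Metric.mem_ball_self hδ) ?_
    · -- the constant translate of `γ` through `x` is uniformly close to `γ`
      have h1 := hball (γ + ContinuousMap.const I (x - γ t)) (by
        rw [dist_eq_norm, add_sub_cancel_left]
        refine lt_of_le_of_lt ((ContinuousMap.norm_le _ (norm_nonneg (x - γ t))).2
          fun s => le_rfl) ?_
        rwa [← dist_eq_norm])
      have h2 := (ContinuousMap.dist_apply_le_dist t).trans h1.le
      simpa [dist_eq_norm] using h2
    · rw [Metric.mem_ball, dist_eq_norm, add_sub_cancel_left]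
      refine (h.norm_coe_le_norm t).trans_lt ?_
      simpa using hh
  rw [add_sub_cancel_left] at key
  exact key.trans (mul_le_mul_of_nonneg_left (h.norm_coe_le_norm t) hε.le)

/-- Substitution into a smooth map is smooth on the space of continuous curves. -/
theorem contDiff_curve_comp {K : A → B} (hK : ContDiff ℝ ∞ K) :
    ContDiff ℝ ∞ (fun γ : C(I, A) => (⟨K, hK.continuous⟩ : C(A, B)).comp γ) := by
  rw [contDiff_infty]
  intro m
  induction m generalizing B with
  | zero =>
    exact contDiff_zero.2 (ContinuousMap.continuous_postcomp _)
  | succ m ih =>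
    have hK' : ContDiff ℝ ∞ (fderiv ℝ K) := hK.fderiv_right (by simp)
    have := contDiff_succ_iff_hasFDerivAt (𝕜 := ℝ) (n := m)
      (f := fun γ : C(I, A) => (⟨K, hK.continuous⟩ : C(A, B)).comp γ)
    refine this.2 ⟨_, ?_, hasFDerivAt_curve_comp
      (fun x => (hK.differentiable (by simp) x).hasFDerivAt) hK.continuous hK'.continuous⟩
    have h1 : ContDiff ℝ m (curveApply (A := A) (B := B)) :=
      ContinuousLinearMap.contDiff (E := C(I, A →L[ℝ] B)) (F := C(I, A) →L[ℝ] C(I, B)) _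
    exact h1.comp (ih hK')

/-- A curve which has derivative `b` is its initial value plus the primitive of `b`. -/
theorem curve_eq_add_primitive [CompleteSpace A] {z : C(I, A)} {Z : ℝ → A} {b : C(I, A)}
    (hz : ∀ t : I, z t = Z t) (hZ : ∀ t : I, HasDerivAt Z (b t) t) :
    z = curveConst (z 0) + curvePrimitive b := by
  ext t
  have h : ∫ s in (0 : ℝ)..t, Set.IccExtend zero_le_one b s = Z t - Z 0 := by
    refine intervalIntegral.integral_eq_sub_of_hasDerivAt (fun s hs => ?_)
      ((b.continuous.Icc_extend').intervalIntegrable _ _)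
    rw [Set.uIcc_of_le t.2.1] at hs
    have hs' : s ∈ Set.Icc (0 : ℝ) 1 := ⟨hs.1, hs.2.trans t.2.2⟩
    rw [Set.IccExtend_of_mem _ _ hs']
    exact hZ ⟨s, hs'⟩
  have h0 := hz 0
  simp only [Set.Icc.coe_zero] at h0
  simp [curvePrimitive_apply, h, hz t, h0]

end Curves

/-! ### The theorem of Frobenius -/

/-- The inverse of `γ ↦ γ + J (B (N γ) (Q γ))` near `0`, where `N` is smooth and `Q ∘ J = 0`,
together with its derivative: it solves the linearised equation. -/
theorem exists_inverse_perturbation {X Y M : Type*} [NormedAddCommGroup X] [NormedSpace ℝ X]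
    [CompleteSpace X] [NormedAddCommGroup Y] [NormedSpace ℝ Y] [NormedAddCommGroup M]
    [NormedSpace ℝ M] (B : M →L[ℝ] Y →L[ℝ] X) (Q : X →L[ℝ] Y) (J : X →L[ℝ] X)
    (hQJ : ∀ x, Q (J x) = 0) {N : X → M} {N' : X → X →L[ℝ] M} (hN : ContDiff ℝ ∞ N)
    (hN' : ∀ γ, HasFDerivAt N (N' γ) γ) :
    ∃ S : X → X, (∀ᶠ c in 𝓝 0, ContDiffAt ℝ ∞ S c) ∧ S 0 = 0 ∧
      (∀ᶠ c in 𝓝 0, S c + J (B (N (S c)) (Q (S c))) = c) ∧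
      (∀ᶠ c in 𝓝 0, ∀ ζ δ, ζ + J (B (N' (S c) ζ) (Q (S c)) + B (N (S c)) (Q ζ)) = δ →
        fderiv ℝ S c δ = ζ) := by
  let Θ : X → X := fun γ => γ + J (B (N γ) (Q γ))
  have hΘ' : ∀ γ η, fderiv ℝ Θ γ η = η + J (B (N' γ η) (Q γ) + B (N γ) (Q η)) := by
    intro γ η
    have h1 : HasFDerivAt (fun γ => B (N γ)) (B ∘L N' γ) γ := B.hasFDerivAt.comp γ (hN' γ)
    have h2 : HasFDerivAt Θ _ γ :=
      (hasFDerivAt_id γ).add (J.hasFDerivAt.comp γ (h1.clm_apply Q.hasFDerivAt))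
    rw [h2.fderiv]
    simp [add_comm]
  have hΘ : ContDiff ℝ ∞ Θ :=
    contDiff_id.add (J.contDiff.comp ((B.contDiff.comp hN).clm_apply Q.contDiff))
  let A : X →L[ℝ] X := J ∘L B (N 0) ∘L Q
  have hAA : ∀ η, A (A η) = 0 := fun η => by simp [A, hQJ]
  let e : X ≃L[ℝ] X := ContinuousLinearEquiv.equivOfInverse
    (ContinuousLinearMap.id ℝ _ + A) (ContinuousLinearMap.id ℝ _ - A)
    (fun η => by simp [hAA]) (fun η => by simp [hAA])
  have hΘ0 : Θ 0 = 0 := by simp [Θ]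
  have he : fderiv ℝ Θ 0 = e := by
    ext1 η
    rw [hΘ']
    simp [e, A]
  obtain ⟨S, hS, hS0, hSΘ, hΘS⟩ := exists_smooth_local_inverse (f := Θ) (a := 0)
    (Eventually.of_forall fun γ => hΘ.contDiffAt) e he
  rw [hΘ0] at hS hS0 hΘS
  have hS0' : Tendsto S (𝓝 0) (𝓝 0) := by
    have := hS.self_of_nhds.continuousAt.tendsto
    rwa [hS0] at this
  refine ⟨S, hS, hS0, hΘS, ?_⟩
  filter_upwards [hS, hS0'.eventually hSΘ.eventually_nhds, hΘS] with c h1 h2 h3 ζ δ h4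
  have h6 : HasFDerivAt (fun γ => S (Θ γ)) (fderiv ℝ S c ∘L fderiv ℝ Θ (S c)) (S c) := by
    refine HasFDerivAt.comp (S c) ?_ (hΘ.differentiable (by simp) _).hasFDerivAt
    rw [h3]
    exact (h1.differentiableAt (by simp)).hasFDerivAt
  have h7 : (fun γ => S (Θ γ)) =ᶠ[𝓝 (S c)] id := h2
  have h8 := h6.fderiv
  rw [h7.fderiv_eq, fderiv_id] at h8
  have h9 := DFunLike.congr_fun h8 ζ
  rw [ContinuousLinearMap.comp_apply, hΘ', h4] at h9
  exact h9.symm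

section Frobenius

variable {n d : ℕ}

theorem SmoothNear.exists_contDiff {W : Type*} [NormedAddCommGroup W] [NormedSpace ℝ W]
    {h : E n → W} (hh : SmoothNear h) :
    ∃ k : E n → W, ContDiff ℝ ∞ k ∧ ∀ᶠ x in 𝓝 (0 : E n), k x = h x := by
  obtain ⟨r, hr, hball⟩ := Metric.eventually_nhds_iff_ball.1 hh
  let f : ContDiffBump (0 : E n) := ⟨r / 4, r / 2, by positivity, by linarith⟩
  refine ⟨fun x => f x • h x, contDiff_iff_contDiffAt.2 fun x => ?_, ?_⟩
  · by_cases hx : x ∈ tsupport f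
    · rw [f.tsupport_eq, Metric.mem_closedBall] at hx
      refine f.contDiffAt.smul (hball x ?_)
      change dist x 0 ≤ r / 2 at hx
      rw [Metric.mem_ball]
      linarith
    · have h0 : (fun x => f x • h x) =ᶠ[𝓝 x] fun _ => 0 := by
        filter_upwards [notMem_tsupport_iff_eventuallyEq.1 hx] with y hy
        simp [hy]
      exact contDiffAt_const.congr_of_eventuallyEq h0
  · filter_upwards [f.eventuallyEq_one] with x hx
    simp [hx]

variable {D : E n → Submodule ℝ (E n)} {π : E n →L[ℝ] (Fin d → ℝ)}
  {K : E n → (Fin d → ℝ) →L[ℝ] E n}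

/-- The fields of an adapted frame of an involutive distribution commute: their brackets lie in
the distribution and have vanishing components under `π`. -/
theorem IsAdapted.commute (h : IsAdapted D π K)
    (hinv : ∀ X Y : E n → E n, IsSection D X → IsSection D Y →
      ∀ᶠ x in 𝓝 (0 : E n), VectorField.lieBracket ℝ X Y x ∈ D x) :
    ∀ᶠ x in 𝓝 (0 : E n), ∀ a b, fderiv ℝ K x (K x a) b = fderiv ℝ K x (K x b) a := by
  have hbr := eventually_all.2 fun i : Fin d => eventually_all.2 fun j : Fin d =>
    hinv _ _ (h.isSection (Pi.single i 1)) (h.isSection (Pi.single j 1))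
  filter_upwards [hbr, h.smooth.differentiableAt, h.proj.eventually_nhds, h.mem_iff]
    with x h1 h2 h3 h4
  have hd : ∀ c v, fderiv ℝ (fun y => K y c) x v = fderiv ℝ K x v c := fun c v => by
    rw [fderiv_clm_apply h2 (differentiableAt_const c)]
    simp
  have hπ : ∀ c v, π (fderiv ℝ K x v c) = 0 := fun c v => by
    have e1 : (fun y => π (K y c)) =ᶠ[𝓝 x] fun _ => c := h3.mono fun y hy => hy c
    have e2 : HasFDerivAt (fun y => π (K y c)) (π ∘L fderiv ℝ (fun y => K y c) x) x :=
      π.hasFDerivAt.comp x (h2.clm_apply (differentiableAt_const c)).hasFDerivAt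
    have e3 := e2.fderiv
    rw [e1.fderiv_eq] at e3
    have e4 := DFunLike.congr_fun e3 v
    simp only [fderiv_fun_const, Pi.zero_apply, zero_apply,
      ContinuousLinearMap.comp_apply, hd] at e4
    exact e4.symm
  have hbasis : ∀ i j : Fin d, fderiv ℝ K x (K x (Pi.single i 1)) (Pi.single j 1) =
      fderiv ℝ K x (K x (Pi.single j 1)) (Pi.single i 1) := fun i j => by
    have e1 := (h4 _).1 (h1 i j)
    rw [VectorField.lieBracket_eq] at e1
    simp only [hd, map_sub, hπ, sub_self, map_zero] at e1
    exact sub_eq_zero.1 e1.symm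
  have hflip : fderiv ℝ K x ∘L K x = (fderiv ℝ K x ∘L K x).flip := by
    refine ContinuousLinearMap.coe_injective ((Pi.basisFun ℝ (Fin d)).ext fun i => ?_)
    refine ContinuousLinearMap.coe_injective ((Pi.basisFun ℝ (Fin d)).ext fun j => ?_)
    simpa using hbasis i j
  intro a b
  exact DFunLike.congr_fun (DFunLike.congr_fun hflip a) b

open unitInterval in
/-- First integrals of an involutive distribution.  Let `γ` be the solution of
`γ' = -K(γ) (π z)`, `γ(0) = z`; it moves inside a leaf, and its endpoint `P z` satisfies
`π (P z) = 0`.  The variation of `γ` in a direction `K(z) a` of the distribution is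
`t ↦ (1 - t) K(γ(t)) a`, because the fields of the frame commute; it vanishes at time `1`.
Smooth dependence of `γ` on `z` is the inverse function theorem for
`Θ γ = γ + ∫ K(γ) (π (γ 0))` on the space of continuous curves, as `Θ γ` is the constant curve `z`
exactly when `γ` solves the equation. -/
theorem exists_first_integrals (h : IsAdapted D π K)
    (hinv : ∀ X Y : E n → E n, IsSection D X → IsSection D Y →
      ∀ᶠ x in 𝓝 (0 : E n), VectorField.lieBracket ℝ X Y x ∈ D x) :
    ∃ P : E n → E n, SmoothNear P ∧
      (∀ᶠ x in 𝓝 (0 : E n), ∀ v ∈ D x, fderiv ℝ P x v = 0) ∧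
      ∀ v, fderiv ℝ P 0 v = v - K 0 (π v) := by
  obtain ⟨k, hk, hkK⟩ := h.smooth.exists_contDiff
  have hcomm : ∀ᶠ x in 𝓝 (0 : E n), ∀ a b, fderiv ℝ k x (k x a) b = fderiv ℝ k x (k x b) a := by
    filter_upwards [h.commute hinv, hkK.eventually_nhds] with x h1 h2 a b
    have h3 : k =ᶠ[𝓝 x] K := h2
    rw [h3.fderiv_eq, h2.self_of_nhds, h1]
  have hkd : ∀ x, HasFDerivAt k (fderiv ℝ k x) x := fun x =>
    (hk.differentiable (by simp) x).hasFDerivAt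
  have hk' : ContDiff ℝ ∞ (fderiv ℝ k) := hk.fderiv_right (by simp)
  -- substitution into `k` and into its derivative
  let N : C(I, E n) → C(I, (Fin d → ℝ) →L[ℝ] E n) := fun γ =>
    (⟨k, hk.continuous⟩ : C(E n, (Fin d → ℝ) →L[ℝ] E n)).comp γ
  let N' : C(I, E n) → C(I, E n →L[ℝ] (Fin d → ℝ) →L[ℝ] E n) := fun γ =>
    (⟨fderiv ℝ k, hk'.continuous⟩ : C(E n, E n →L[ℝ] (Fin d → ℝ) →L[ℝ] E n)).comp γ
  have hN : ContDiff ℝ ∞ N := contDiff_curve_comp hk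
  have hN' : ∀ γ, HasFDerivAt N (curveApply (N' γ)) γ := fun γ =>
    hasFDerivAt_curve_comp hkd hk.continuous hk'.continuous γ
  let ev : I → C(I, E n) →L[ℝ] E n := fun t => ContinuousMap.evalCLM ℝ t
  let Q : C(I, E n) →L[ℝ] C(I, Fin d → ℝ) := curveConst ∘L π ∘L ev 0
  have hQ : ∀ γ t, Q γ t = π (γ 0) := fun γ t => rfl
  let J : C(I, E n) →L[ℝ] C(I, E n) := curvePrimitive
  have hJ0 : ∀ b, J b 0 = 0 := fun b => by
    simp [J, curvePrimitive_apply]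
  have hQJ : ∀ b, Q (J b) = 0 := fun b => by
    ext t : 1
    rw [hQ, hJ0, map_zero]
    rfl
  obtain ⟨S, hS, hS0, hΘS, hSd⟩ := exists_inverse_perturbation
    (curveApply (A := Fin d → ℝ) (B := E n)) Q J hQJ hN hN'
  have hc0 : Tendsto (fun z : E n => (curveConst z : C(I, E n))) (𝓝 0) (𝓝 0) := by
    have := (curveConst (A := E n)).continuous.tendsto 0
    rwa [map_zero] at this
  have hsol : Tendsto (fun z : E n => S (curveConst z)) (𝓝 0) (𝓝 0) := by
    have := hS.self_of_nhds.continuousAt.tendsto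
    rw [hS0] at this
    exact this.comp hc0
  -- a solution of the linearised equation is the derivative of the solution operator
  have hvar : ∀ᶠ z in 𝓝 (0 : E n), ∀ (ζ : C(I, E n)) (δ : E n),
      ζ + J (curveApply (curveApply (N' (S (curveConst z))) ζ) (Q (S (curveConst z))) +
        curveApply (N (S (curveConst z))) (Q ζ)) = curveConst δ →
      fderiv ℝ (fun z => ev 1 (S (curveConst z))) z δ = ζ 1 := by
    filter_upwards [hc0.eventually hS, hc0.eventually hSd] with z h1 h2 ζ δ h3
    have h4 : HasFDerivAt (fun z => S (curveConst z)) (fderiv ℝ S (curveConst z) ∘L curveConst) z :=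
      HasFDerivAt.comp z (h1.differentiableAt (by simp)).hasFDerivAt 
        (ContinuousLinearMap.hasFDerivAt (E := E n) (F := C(I, E n)) curveConst)
    have h5 : HasFDerivAt (fun z => ev 1 (S (curveConst z)))
        (ev 1 ∘L fderiv ℝ S (curveConst z) ∘L curveConst) z :=
      (ev 1).hasFDerivAt.comp z h4
    rw [h5.fderiv, ← h2 ζ _ h3]
    rfl
  refine ⟨fun z => ev 1 (S (curveConst z)), ?_, ?_, ?_⟩
  · filter_upwards [hc0.eventually hS] with z hz
    exact (ev 1).contDiff.contDiffAt.comp z (hz.comp z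
      (ContinuousLinearMap.contDiff (E := E n) (F := C(I, E n)) curveConst).contDiffAt)
  · have hcomm' : ∀ᶠ γ in 𝓝 (0 : C(I, E n)), ∀ t, ∀ a b,
        fderiv ℝ k (γ t) (k (γ t) a) b = fderiv ℝ k (γ t) (k (γ t) b) a := by
      obtain ⟨r, hr, hball⟩ := Metric.eventually_nhds_iff_ball.1 hcomm
      filter_upwards [Metric.ball_mem_nhds (0 : C(I, E n)) hr] with γ hγ t
      refine hball (γ t) (Metric.mem_ball.2 (lt_of_le_of_lt ?_ hγ))
      exact ContinuousMap.dist_apply_le_dist (f := γ) (g := 0) t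
    filter_upwards [hvar, hsol.eventually hcomm', hc0.eventually hΘS, hkK, h.proj, h.mem_iff]
      with z h1 h2 h3 h4 h5 h6 v hv
    rw [h6, ← h4] at hv
    rw [← h4] at h5
    generalize S (curveConst z) = γ at h1 h2 h3
    set a := π v with ha
    have hγ0 : γ 0 = z := by
      have := DFunLike.congr_fun h3 0
      rwa [ContinuousMap.add_apply, hJ0, add_zero] at this
    let b : C(I, E n) := curveApply (N γ) (Q γ)
    have hb : ∀ t, b t = k (γ t) (π z) := fun t => by
      rw [← hγ0]
      rfl
    -- the extension of the curve `γ` to all times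
    let Γ : ℝ → E n := fun s => z - ∫ τ in (0 : ℝ)..s, Set.IccExtend zero_le_one b τ
    have hΓγ : ∀ t : I, Γ t = γ t := fun t => by
      have := DFunLike.congr_fun h3 t
      simp only [J, ContinuousMap.add_apply, curvePrimitive_apply, curveConst_apply] at this
      exact sub_eq_of_eq_add this.symm
    have hΓ : ∀ t : I, HasDerivAt Γ (-b t) t := fun t => by
      have h7 := (b.continuous.Icc_extend' (h := zero_le_one)).integral_hasStrictDerivAt 0 (t : ℝ)
      have h8 := h7.hasDerivAt.const_sub z
      rwa [Set.IccExtend_val] at h8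
    let ζ : C(I, E n) := ⟨fun t => (1 - (t : ℝ)) • k (γ t) a, by
      have := hk.continuous
      fun_prop⟩
    have hζ : ∀ t, ζ t = (1 - (t : ℝ)) • k (γ t) a := fun t => rfl
    have hζ0 : ζ 0 = v := by simp [hζ, hγ0, hv]
    have hQζ : ∀ t, Q ζ t = a := fun t => by rw [hQ, hζ0, ha]
    have hvarζ : ζ = curveConst (ζ 0) +
        curvePrimitive (-(curveApply (curveApply (N' γ) ζ) (Q γ) + curveApply (N γ) (Q ζ))) := by
      refine curve_eq_add_primitive (Z := fun s => (1 - s) • k (Γ s) a)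
        (fun t => by rw [hζ, hΓγ]) fun t => ?_
      have h7 : HasDerivAt (fun s => k (Γ s)) (fderiv ℝ k (Γ t) (-b t)) t :=
        (hkd (Γ t)).comp_hasDerivAt (t : ℝ) (hΓ t)
      have h8 := h7.clm_apply (hasDerivAt_const (t : ℝ) a)
      have h9 := ((hasDerivAt_id (t : ℝ)).const_sub 1).smul h8
      convert! h9 using 1
      have h10 : (Q γ) t = π z := by rw [hQ, hγ0]
      have h11 : (N' γ) t = fderiv ℝ k (γ t) := rfl
      have h12 : (N γ) t = k (γ t) := rfl
      simp only [hQζ, ContinuousMap.neg_apply, ContinuousMap.add_apply, curveApply_apply,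
        h10, h11, h12, hζ, hΓγ, hb, map_smul, map_neg,
        smul_apply, h2 t a (π z)]
      simp
      abel
    rw [h1 ζ v ?_]
    · simp [hζ]
    · nth_rw 1 [hvarζ]
      rw [hζ0, map_neg]
      exact neg_add_cancel_right _ _
  · intro δ
    have hζ : Q (curveConst δ - J (curveApply (N 0) (Q (curveConst δ)))) = Q (curveConst δ) := by
      rw [map_sub, hQJ, sub_zero]
    have h1 : N 0 = curveConst (K 0) := by
      ext t : 1
      exact hkK.self_of_nhds
    rw [hvar.self_of_nhds (curveConst δ - J (curveApply (N 0) (Q (curveConst δ)))) δ]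
    · have h2 : curveApply (N 0) (Q (curveConst δ)) = curveConst (K 0 (π δ)) := by
        rw [h1]
        rfl
      have h3 : J (curveConst (K 0 (π δ))) 1 = K 0 (π δ) := by
        simp [J, curvePrimitive_apply, Set.IccExtend]
      rw [h2, ContinuousMap.sub_apply, h3, curveConst_apply]
    · rw [map_zero, hS0, hζ]
      simp

end Frobenius

/-! ### The distributions of a chain -/

section Chains

variable {n : ℕ}

theorem IsInvolutiveDistribution.exists_isAdapted {d : ℕ} {D : E n → Submodule ℝ (E n)}
    (h : IsInvolutiveDistribution d D) :
    ∃ (π : E n →L[ℝ] (Fin d → ℝ)) (K : E n → (Fin d → ℝ) →L[ℝ] E n), IsAdapted D π K :=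
  TriForm.exists_isAdapted h.frame

theorem IsInvolutiveDistribution.finrank {d : ℕ} {D : E n → Submodule ℝ (E n)}
    (h : IsInvolutiveDistribution d D) :
    ∀ᶠ x in 𝓝 (0 : E n), Module.finrank ℝ (D x) = d := by
  obtain ⟨π, K, hK⟩ := h.exists_isAdapted
  exact hK.finrank

theorem IsInvolutiveDistribution.le_of_densely {d d' : ℕ} {D D' : E n → Submodule ℝ (E n)}
    (h : IsInvolutiveDistribution d D) (h' : IsInvolutiveDistribution d' D')
    (hd : DenselyNear fun x => D x ≤ D' x) : ∀ᶠ x in 𝓝 (0 : E n), D x ≤ D' x := by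
  obtain ⟨π, K, hK⟩ := h.exists_isAdapted
  obtain ⟨π', K', hK'⟩ := h'.exists_isAdapted
  exact hK.le_of_densely hK' hd

theorem IsInvolutiveDistribution.eq_of_densely {d d' : ℕ} {D D' : E n → Submodule ℝ (E n)}
    (h : IsInvolutiveDistribution d D) (h' : IsInvolutiveDistribution d' D')
    (hd : DenselyNear fun x => D x = D' x) : ∀ᶠ x in 𝓝 (0 : E n), D x = D' x := by
  filter_upwards [h.le_of_densely h' (hd.mono fun _ hx => hx.le),
    h'.le_of_densely h (hd.mono fun _ hx => hx.ge)] with x h1 h2 using le_antisymm h1 h2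

theorem isInvolutiveDistribution_bot :
    IsInvolutiveDistribution 0 (fun _ : E n => (⊥ : Submodule ℝ (E n))) where
  frame := ⟨fun a => a.elim0, fun a => a.elim0, Eventually.of_forall fun x =>
    ⟨linearIndependent_empty_type, by simp⟩⟩
  involutive X Y hX hY := by
    have hX0 : X =ᶠ[𝓝 0] fun _ => 0 := hX.2.mono fun x hx => by simpa using hx
    have hY0 : Y =ᶠ[𝓝 0] fun _ => 0 := hY.2.mono fun x hx => by simpa using hx
    filter_upwards [hX0.eventuallyEq_nhds, hY0.eventuallyEq_nhds] with x h1 h2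
    rw [h1.lieBracket_vectorField_eq h2]
    simp

theorem isInvolutiveDistribution_span {G : E n → E n} (hG : SmoothNear G)
    (hG0 : ∃ j : Fin n, G 0 j ≠ 0) :
    IsInvolutiveDistribution 1 (fun x => Submodule.span ℝ {G x}) where
  frame := by
    obtain ⟨j, hj⟩ := hG0
    refine ⟨fun _ => G, fun _ => hG, ?_⟩
    have h0 : G 0 ≠ 0 := fun h => hj (by simp [h])
    filter_upwards [hG.self_of_nhds.continuousAt.eventually_ne h0] with x hx
    exact ⟨LinearIndependent.of_subsingleton 0 hx, by simp⟩
  involutive X Y hX hY := by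
    obtain ⟨j, hj⟩ := hG0
    have hGj : SmoothNear fun x => G x j := hG.mono fun x hx => contDiffAt_pi.1 hx j
    -- near the origin sections are multiples of `G` by quotients of components
    have hcoef : ∀ Z, IsSection (fun x => Submodule.span ℝ {G x}) Z →
        SmoothNear (fun x => Z x j / G x j) ∧
          ∀ᶠ x in 𝓝 (0 : E n), Z x = (Z x j / G x j) • G x := fun Z hZ => by
      constructor
      · filter_upwards [hGj, hZ.1, hGj.self_of_nhds.continuousAt.eventually_ne hj]
          with x h1 h2 h3 using (contDiffAt_pi.1 h2 j).div h1 h3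
      · filter_upwards [hZ.2, hGj.self_of_nhds.continuousAt.eventually_ne hj] with x h1 h2
        obtain ⟨c, hc⟩ := Submodule.mem_span_singleton.1 h1
        rw [← hc, Pi.smul_apply, smul_eq_mul, mul_div_cancel_right₀ _ h2]
    obtain ⟨hX1, hX2⟩ := hcoef X hX
    obtain ⟨hY1, hY2⟩ := hcoef Y hY
    filter_upwards [hX1.differentiableAt, hY1.differentiableAt, hX2.eventually_nhds,
      hY2.eventually_nhds, hG.differentiableAt] with x h1 h2 h3 h4 h5
    have h6 : VectorField.lieBracket ℝ X Y x = VectorField.lieBracket ℝ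
        (fun x => (X x j / G x j) • G x) (fun x => (Y x j / G x j) • G x) x :=
      Filter.EventuallyEq.lieBracket_vectorField_eq h3 h4
    have hmem : G x ∈ Submodule.span ℝ {G x} := Submodule.mem_span_singleton_self _
    rw [h6, VectorField.lieBracket_smul_right h2 h5, VectorField.lieBracket_smul_left h1 h5,
      VectorField.lieBracket_self]
    refine add_mem (Submodule.smul_mem _ _ hmem) (Submodule.smul_mem _ _ (add_mem ?_ ?_))
    · exact Submodule.smul_mem _ _ hmem
    · simp

variable {F G : E n → E n} {i : ℕ} {D Dhat : ℕ → E n → Submodule ℝ (E n)} {H : ℕ → E n → E n}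

/-- All the distributions of a chain, including the initial ones `span {G}` and `0`, are
involutive of the expected rank; `n + 1 - k` agrees with `n - k + 1` for `k ≤ n` and is also right
for `k = n + 1`. -/
theorem IsChain.isInvolutiveDistribution (h : IsChain F G i D Dhat H) (hG : SmoothNear G)
    (hG0 : ∃ j : Fin n, G 0 j ≠ 0) {k : ℕ} (hik : i ≤ k) (hk : k ≤ n + 1) :
    IsInvolutiveDistribution (n + 1 - k) (D k) := by
  rcases (by omega : k < n ∨ k = n ∨ k = n + 1) with hk | rfl | rfl
  · have := h.distribution k hik hk
    rwa [show n - k + 1 = n + 1 - k by omega] at this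
  · rw [funext h.input, show k + 1 - k = 1 by omega]
    exact isInvolutiveDistribution_span hG hG0
  · rw [funext h.zero, Nat.sub_self]
    exact isInvolutiveDistribution_bot

theorem IsChain.densely_eq_hat (h : IsChain F G i D Dhat H) {k : ℕ} (hik : i ≤ k) (hk : k ≤ n) :
    DenselyNear fun x => D k x = Dhat k x := by
  rcases hk.lt_or_eq with hk | rfl
  · exact h.agree k hik hk
  · exact .of_eventually (Eventually.of_forall fun x => by rw [h.input, h.input_hat])

/-- In a distribution of larger rank there is a field outside a given distribution. -/
theorem IsInvolutiveDistribution.exists_isChoice {d d' : ℕ} {D D' : E n → Submodule ℝ (E n)}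
    (h : IsInvolutiveDistribution d D) (h' : IsInvolutiveDistribution d' D') (hd : d' < d) :
    ∃ X, IsChoice D D' X := by
  obtain ⟨π, K, hK⟩ := h.exists_isAdapted
  obtain ⟨π', K', hK'⟩ := h'.exists_isAdapted
  obtain ⟨c, hc⟩ : ∃ c, K 0 c ∉ D' 0 := by
    by_contra! hcon
    have hle : D 0 ≤ D' 0 := fun v hv => by
      rw [hK.mem_iff.self_of_nhds] at hv
      rw [← hv]
      exact hcon _
    have := Submodule.finrank_mono hle
    rw [hK.finrank.self_of_nhds, hK'.finrank.self_of_nhds] at this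
    omega
  exact ⟨fun x => K x c, hK.isSection c,
    .of_eventually (hK'.eventually_notMem (hK.isSection c).1 hc)⟩

/-- If every step can be carried out, a full chain is obtained by recursion. -/
theorem conditionForSomeChoices_of_forall (hG : SmoothNear G) (hG0 : ∃ j : Fin n, G 0 j ≠ 0)
    (h : ConditionForAllChoices F G) : ConditionForSomeChoices F G := by
  have hn : 1 ≤ n := by
    obtain ⟨j, _⟩ := hG0
    exact j.pos
  refine Nat.decreasingInduction' (m := 1) (n := n)
    (P := fun i => ∃ D Dhat H, IsChain F G i D Dhat H) ?_ hn ?_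
  · rintro i hin h1 ⟨D, Dhat, H, hc⟩
    obtain ⟨X, hX⟩ :=
      (hc.isInvolutiveDistribution hG hG0 (k := i + 1) le_rfl (by omega)).exists_isChoice
        (hc.isInvolutiveDistribution hG hG0 (k := i + 2) (by omega) (by omega)) (by omega)
    obtain ⟨D', hD', hagree⟩ := h i h1 hin D Dhat H hc X hX
    refine ⟨Function.update D i D', Function.update Dhat i (adSpan F X (Dhat (i + 1))),
      Function.update H (i + 1) X, ?_, ?_, ?_, ?_, ?_, ?_, ?_⟩
    · intro x
      rw [Function.update_of_ne (by omega)]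
      exact hc.zero x
    · intro x
      rw [Function.update_of_ne (by omega)]
      exact hc.input x
    · intro x
      rw [Function.update_of_ne (by omega)]
      exact hc.input_hat x
    · intro k hik hk
      rw [Function.update_of_ne (by omega), Function.update_of_ne (by omega)]
      rcases hik.eq_or_lt with rfl | hik
      · rwa [Function.update_self]
      · rw [Function.update_of_ne (by omega)]
        exact hc.choice k hik hk
    · intro k hik hk
      rw [Function.update_of_ne (a := k + 1) (a' := i) (by omega)]
      rcases hik.eq_or_lt with rfl | hik
      · rw [Function.update_self, Function.update_self]
      · rw [Function.update_of_ne (by omega), Function.update_of_ne (by omega)]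
        exact hc.hat k hik hk
    · intro k hik hk
      rcases hik.eq_or_lt with rfl | hik
      · rwa [Function.update_self]
      · rw [Function.update_of_ne (by omega)]
        exact hc.distribution k hik hk
    · intro k hik hk
      rcases hik.eq_or_lt with rfl | hik
      · simpa only [Function.update_self] using hagree
      · simp only [Function.update_of_ne (show k ≠ i by omega)]
        exact hc.agree k hik hk
  -- before the first step there are only `D (n + 1) = 0` and `D n = Dhat n = span {G}`
  · refine ⟨fun k x => if k = n + 1 then ⊥ else Submodule.span ℝ {G x},
      fun _ x => Submodule.span ℝ {G x}, fun _ => G, ?_, ?_, ?_, ?_, ?_, ?_, ?_⟩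
    · simp
    · simp
    · simp
    all_goals exact fun k h1 h2 => absurd h1 (by omega)

end Chains

/-! ### Local coordinates and their coordinate flags -/

section Charts

variable {n : ℕ}

/-- `T` is a smooth system of coordinates near the origin, with smooth local inverse `S`. -/
structure IsChart (T S : E n → E n) : Prop where
  smooth : SmoothNear T
  smooth_symm : SmoothNear S
  map_zero : T 0 = 0
  left_inv : ∀ᶠ ξ in 𝓝 (0 : E n), S (T ξ) = ξ
  right_inv : ∀ᶠ x in 𝓝 (0 : E n), T (S x) = x

/-- The distribution on which the first `k - 1` coordinates of `T` are constant, that is, the span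
of the coordinate fields with (one-based) index at least `k`. -/
def coordFlag (T : E n → E n) (k : ℕ) (x : E n) : Submodule ℝ (E n) where
  carrier := {v | ∀ j : Fin n, (j : ℕ) + 1 < k → fderiv ℝ (fun y => T y j) x v = 0}
  add_mem' := fun ha hb j hj => by rw [map_add, ha j hj, hb j hj, add_zero]
  zero_mem' := fun _ _ => map_zero _
  smul_mem' := fun c v hv j hj => by rw [map_smul, hv j hj, smul_zero]

theorem coordFlag_anti {T : E n → E n} {k l : ℕ} (h : k ≤ l) (x : E n) :
    coordFlag T l x ≤ coordFlag T k x :=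
  fun _ hv j hj => hv j (hj.trans_le h)

theorem SmoothNear.apply {T : E n → E n} (hT : SmoothNear T) (j : Fin n) :
    SmoothNear fun y => T y j :=
  hT.mono fun _ hx => contDiffAt_pi.1 hx j

theorem SmoothNear.fderiv_apply {T : E n → E n} (hT : SmoothNear T) :
    ∀ᶠ x in 𝓝 (0 : E n), ∀ v j, _root_.fderiv ℝ T x v j = _root_.fderiv ℝ (fun y => T y j) x v := by
  filter_upwards [hT.differentiableAt] with x hx v j
  rw [fderiv_pi fun j => differentiableAt_pi.1 hx j]
  rfl

variable {T S : E n → E n}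

theorem IsChart.symm_zero (h : IsChart T S) : S 0 = 0 := by
  have := h.left_inv.self_of_nhds
  rwa [h.map_zero] at this

theorem IsChart.symm (h : IsChart T S) : IsChart S T :=
  ⟨h.smooth_symm, h.smooth, h.symm_zero, h.right_inv, h.left_inv⟩

theorem IsChart.tendsto (h : IsChart T S) : Tendsto T (𝓝 0) (𝓝 0) :=
  h.smooth.tendsto h.map_zero

theorem IsChart.fderiv_symm_fderiv (h : IsChart T S) :
    ∀ᶠ ξ in 𝓝 (0 : E n), ∀ v, fderiv ℝ S (T ξ) (fderiv ℝ T ξ v) = v := by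
  filter_upwards [h.left_inv.eventually_nhds, h.smooth.differentiableAt,
    h.tendsto.eventually h.smooth_symm.differentiableAt] with ξ h1 h2 h3 v
  have h4 := (h3.hasFDerivAt.comp ξ h2.hasFDerivAt).fderiv
  have h5 : S ∘ T =ᶠ[𝓝 ξ] id := h1
  rw [h5.fderiv_eq, fderiv_id] at h4
  exact (DFunLike.congr_fun h4 v).symm

theorem IsChart.fderiv_fderiv_symm (h : IsChart T S) :
    ∀ᶠ ξ in 𝓝 (0 : E n), ∀ w, fderiv ℝ T ξ (fderiv ℝ S (T ξ) w) = w := by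
  filter_upwards [h.tendsto.eventually h.symm.fderiv_symm_fderiv, h.left_inv] with ξ h1 h2 w
  have := h1 w
  rwa [h2] at this

theorem IsChart.denselyNear (h : IsChart T S) {P : E n → Prop} (hP : DenselyNear P) :
    DenselyNear fun x => P (T x) :=
  hP.comp h.map_zero h.smooth.continuousAt h.smooth_symm.continuousAt h.right_inv h.left_inv

/-- The coordinate flag is spanned by the coordinate fields, the columns of the derivative of the
inverse chart. -/
theorem IsChart.isInvolutiveDistribution (h : IsChart T S) {k : ℕ} (hk : 1 ≤ k) :
    IsInvolutiveDistribution (n + 1 - k) (coordFlag T k) where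
  frame := by
    let σ : Fin (n + 1 - k) → Fin n := fun a => ⟨k - 1 + a, by omega⟩
    have hσ : Function.Injective σ := fun a b hab => by
      have := congrArg Fin.val hab
      simp only [σ] at this
      exact Fin.ext (by omega)
    refine ⟨fun a ξ => fderiv ℝ S (T ξ) (Pi.single (σ a) 1), fun a => ?_, ?_⟩
    · exact (h.smooth_symm.fderiv.comp h.smooth h.map_zero).clm_apply (.const _)
    · filter_upwards [h.fderiv_symm_fderiv, h.fderiv_fderiv_symm, h.smooth.fderiv_apply]
        with ξ h1 h2 h3
      constructor
      · refine LinearIndependent.of_comp (fderiv ℝ T ξ : E n →ₗ[ℝ] E n) ?_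
        have h4 := (Pi.basisFun ℝ (Fin n)).linearIndependent.comp σ hσ
        convert! h4 using 1
        ext1 a
        simp [h2]
      · apply le_antisymm
        · intro v hv
          have h4 : v = ∑ j, fderiv ℝ T ξ v j • fderiv ℝ S (T ξ) (Pi.single j 1) := by
            rw [← map_eq_sum_single, h1]
          rw [h4]
          refine Submodule.sum_mem _ fun j _ => ?_
          by_cases hj : (j : ℕ) + 1 < k
          · rw [h3, hv j hj, zero_smul]
            exact Submodule.zero_mem _
          · refine Submodule.smul_mem _ _ (Submodule.subset_span ⟨⟨j - (k - 1), by omega⟩, ?_⟩)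
            have : σ ⟨j - (k - 1), by omega⟩ = j := Fin.ext (by simp only [σ]; omega)
            simp only [this]
        · rw [Submodule.span_le]
          rintro _ ⟨a, rfl⟩ j hj
          rw [← h3, h2, Pi.single_eq_of_ne]
          intro hja
          have := congrArg Fin.val hja
          simp only [σ] at this
          omega
  involutive X Y hX hY := by
    have : ∀ j : Fin n, ∀ᶠ x in 𝓝 (0 : E n), (j : ℕ) + 1 < k →
        fderiv ℝ (fun y => T y j) x (VectorField.lieBracket ℝ X Y x) = 0 := fun j => by
      by_cases hj : (j : ℕ) + 1 < k
      · filter_upwards [(h.smooth.apply j).fderiv_lieBracket hX.1 hY.1,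
          fderiv_eq_zero_of_eventually (hX.2.mono fun x hx => hx j hj),
          fderiv_eq_zero_of_eventually (hY.2.mono fun x hx => hx j hj)] with x h1 h2 h3 _
        rw [h1, h2, h3]
        simp
      · exact Eventually.of_forall fun _ hj' => absurd hj' hj
    exact (eventually_all.2 this).mono fun x hx j hj => hx j hj

theorem IsChart.coordFlag_eq_bot (h : IsChart T S) :
    ∀ᶠ x in 𝓝 (0 : E n), coordFlag T (n + 1) x = ⊥ := by
  filter_upwards [h.smooth.fderiv_apply, h.fderiv_symm_fderiv] with x h1 h2
  refine (Submodule.eq_bot_iff _).2 fun v hv => ?_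
  have : fderiv ℝ T x v = 0 := by
    ext j
    rw [h1, hv j (by omega)]
    rfl
  rw [← h2 v, this, _root_.map_zero]

end Charts

/-! ### From triangular forms to the construction -/

section Triangular

variable {n : ℕ} {T S F f g : E n → E n}

theorem IsLowerTriangular.partial_eq_zero (h : IsLowerTriangular f g) :
    ∀ᶠ x in 𝓝 (0 : E n), ∀ l m : Fin n, (l : ℕ) + 1 < m →
      fderiv ℝ (fun y => f y l) x (Pi.single m 1) = 0 := by
  obtain ⟨U, hU, hf⟩ := h.triangular
  filter_upwards [eventually_mem_nhds_iff.2 hU, h.smooth_f] with x hx hs l m hlm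
  have h1 : DifferentiableAt ℝ (fun y => f y l) x :=
    (contDiffAt_pi.1 hs l).differentiableAt (by simp)
  rw [← h1.lineDeriv_eq_fderiv, lineDeriv]
  have h2 : ContinuousAt (fun t : ℝ => x + t • (Pi.single m 1 : E n)) 0 := by fun_prop
  have h3 : (fun t : ℝ => f (x + t • (Pi.single m 1 : E n)) l) =ᶠ[𝓝 0] fun _ => f x l := by
    have h4 : U ∈ 𝓝 (x + (0 : ℝ) • (Pi.single m 1 : E n)) := by simpa using hx
    filter_upwards [h2.eventually_mem h4] with t ht
    refine hf _ ht _ (mem_of_mem_nhds hx) l fun j hj => ?_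
    have : j ≠ m := fun hjm => by
      subst hjm
      omega
    simp [this]
  rw [h3.deriv_eq, deriv_const]

/-- One step of the construction in coordinates with triangular drift: for a field `X` with
(one-based) components starting at `k + 1`, the components of `[X, F]` start at `k`, and the
`k`-th one is `∂f_k/∂x_{k+1}` times the leading component of `X`. -/
theorem IsChart.adSpan_coordFlag (h : IsChart T S) (hF : SmoothNear F)
    (hf : IsLowerTriangular f g)
    (hFf : ∀ᶠ ξ in 𝓝 (0 : E n), ∀ j : Fin n, (j : ℕ) + 1 < n →
      fderiv ℝ (fun y => T y j) ξ (F ξ) = f (T ξ) j)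
    {k : ℕ} (hk : 1 ≤ k) (hkn : k < n) {X : E n → E n}
    (hX : IsChoice (coordFlag T (k + 1)) (coordFlag T (k + 2)) X) :
    DenselyNear fun x => Submodule.span ℝ {VectorField.lieBracket ℝ X F x} ⊔
      coordFlag T (k + 1) x = coordFlag T k x := by
  let p : Fin n := ⟨k - 1, by omega⟩
  let q : Fin n := ⟨k, hkn⟩
  -- the leading component of `X`
  have hlead : DenselyNear fun x => fderiv ℝ (fun y => T y q) x (X x) ≠ 0 := by
    refine hX.2.mono_eventually (hX.1.2.mono fun x h1 h2 h3 => h2 fun j hj => ?_)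
    rcases (by omega : (j : ℕ) + 1 < k + 1 ∨ (j : ℕ) = k) with hj | hj
    · exact h1 j hj
    · rwa [show j = q from Fin.ext hj]
  have hpart : DenselyNear fun x => fderiv ℝ (fun y => f y p) (T x) (Pi.single q 1) ≠ 0 :=
    h.denselyNear (hf.partial_ne p q (by simp only [p, q]; omega))
  -- the components of the bracket
  have hbr : ∀ᶠ x in 𝓝 (0 : E n), ∀ l : Fin n, (l : ℕ) + 1 ≤ k →
      fderiv ℝ (fun y => T y l) x (VectorField.lieBracket ℝ X F x) =
        fderiv ℝ (fun y => f y l) (T x) (fderiv ℝ T x (X x)) := by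
    refine eventually_all.2 fun l => ?_
    by_cases hl : (l : ℕ) + 1 ≤ k
    · filter_upwards [(h.smooth.apply l).fderiv_lieBracket hX.1.1 hF,
        fderiv_eq_zero_of_eventually (hX.1.2.mono fun x hx => hx l (by omega)),
        hFf.eventually_nhds, h.smooth.differentiableAt,
        h.tendsto.eventually (hf.smooth_f.apply l).differentiableAt] with x h1 h2 h3 h4 h5 _
      have h6 : (fun y => fderiv ℝ (fun y => T y l) y (F y)) =ᶠ[𝓝 x]
          (fun y => f y l) ∘ T := h3.mono fun y hy => hy l (by omega)
      rw [h1, h2, h6.fderiv_eq, (h5.hasFDerivAt.comp x h4.hasFDerivAt).fderiv]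
      simp
    · exact Eventually.of_forall fun _ hl' => absurd hl' hl
  have hsum : ∀ᶠ x in 𝓝 (0 : E n), ∀ l : Fin n, (l : ℕ) + 1 ≤ k →
      fderiv ℝ (fun y => T y l) x (VectorField.lieBracket ℝ X F x) =
        if l = p then fderiv ℝ (fun y => T y q) x (X x) *
          fderiv ℝ (fun y => f y p) (T x) (Pi.single q 1) else 0 := by
    filter_upwards [hbr, h.smooth.fderiv_apply, hX.1.2,
      h.tendsto.eventually hf.partial_eq_zero] with x h1 h2 h3 h4 l hl
    have hterm : ∀ m : Fin n, m ≠ q ∨ l ≠ p → fderiv ℝ T x (X x) m *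
        fderiv ℝ (fun y => f y l) (T x) (Pi.single m 1) = 0 := fun m hm => by
      by_cases hmk : (m : ℕ) + 1 < k + 1
      · rw [h2, h3 m hmk, zero_mul]
      · rw [h4 l m, mul_zero]
        rcases hm with hm | hm
        · have : (m : ℕ) ≠ k := fun h => hm (Fin.ext h)
          omega
        · have : (l : ℕ) ≠ k - 1 := fun h => hm (Fin.ext h)
          omega
    have hexp : fderiv ℝ (fun y => f y l) (T x) (fderiv ℝ T x (X x)) =
        ∑ m, fderiv ℝ T x (X x) m * fderiv ℝ (fun y => f y l) (T x) (Pi.single m 1) :=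
      map_eq_sum_single _ _
    rw [h1 l hl, hexp]
    split_ifs with hlp
    · subst hlp
      rw [Finset.sum_eq_single q (fun m _ hm => hterm m (Or.inl hm)) (by simp), h2]
    · exact Finset.sum_eq_zero fun m _ => hterm m (Or.inr hlp)
  refine (hlead.and hpart).mono_eventually (hsum.mono fun x h1 ⟨h2, h3⟩ => ?_)
  have hne := mul_ne_zero h2 h3
  have hp := h1 p (by simp only [p]; omega)
  rw [if_pos rfl] at hp
  rw [← hp] at hne
  apply le_antisymm
  · refine sup_le ((Submodule.span_singleton_le_iff_mem _ _).2 fun j hj => ?_)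
      (coordFlag_anti (Nat.le_succ k) x)
    rw [h1 j hj.le, if_neg]
    intro hjp
    have := congrArg Fin.val hjp
    simp only [p] at this
    omega
  · intro v hv
    set w := VectorField.lieBracket ℝ X F x
    have hw : ∀ j : Fin n, (j : ℕ) + 1 < k → fderiv ℝ (fun y => T y j) x w = 0 := fun j hj => by
      rw [h1 j hj.le, if_neg]
      intro hjp
      have := congrArg Fin.val hjp
      simp only [p] at this
      omega
    set c := fderiv ℝ (fun y => T y p) x v / fderiv ℝ (fun y => T y p) x w
    rw [← add_sub_cancel (c • w) v]
    refine Submodule.add_mem_sup (Submodule.smul_mem _ _ (Submodule.mem_span_singleton_self w))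
      fun j hj => ?_
    rcases (by omega : (j : ℕ) + 1 < k ∨ (j : ℕ) = k - 1) with hj | hj
    · rw [map_sub, map_smul, hw j hj, hv j hj]
      simp
    · rw [show j = p from Fin.ext hj, map_sub, map_smul, smul_eq_mul, div_mul_cancel₀ _ hne,
        sub_self]

/-- In the coordinates of a triangular form every choice made in the construction produces the
coordinate flag: the distributions agree with it densely, hence everywhere near the origin. -/
theorem conditionForAllChoices_of_equivalent {G : E n → E n} (hF : SmoothNear F)
    (hG : SmoothNear G) (hG0 : ∃ j : Fin n, G 0 j ≠ 0)
    (h : LocallyEquivalentToTriangular F G) : ConditionForAllChoices F G := by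
  obtain ⟨α, β, T, S, f, g, hα, hβ, hβ0, hT, hS, hT0, hST, hTS, hfg, hFf, hGg⟩ := h
  have hc : IsChart T S := ⟨hT, hS, hT0, hST, hTS⟩
  -- the input field is tangent to the last coordinate line
  have hGcomp : ∀ᶠ ξ in 𝓝 (0 : E n), ∀ j : Fin n, (j : ℕ) + 1 < n →
      fderiv ℝ (fun y => T y j) ξ (G ξ) = 0 := by
    filter_upwards [hGg, hT.fderiv_apply, hβ.self_of_nhds.continuousAt.eventually_ne hβ0,
      hc.tendsto.eventually hfg.input_zero] with ξ h1 h2 h3 h4 j hj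
    have h5 := congrFun h1 j
    rw [h2, h4 j hj, map_smul, smul_eq_mul] at h5
    exact (mul_eq_zero.1 h5).resolve_left h3
  -- feedback only changes the last component of the drift
  have hFcomp : ∀ᶠ ξ in 𝓝 (0 : E n), ∀ j : Fin n, (j : ℕ) + 1 < n →
      fderiv ℝ (fun y => T y j) ξ (F ξ) = f (T ξ) j := by
    filter_upwards [hFf, hT.fderiv_apply, hGcomp] with ξ h1 h2 h3 j hj
    rw [← h1, h2, map_add, map_smul, h3 j hj, smul_zero, add_zero]
  have hDn : ∀ᶠ x in 𝓝 (0 : E n), Submodule.span ℝ {G x} = coordFlag T n x := by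
    have hn : 1 ≤ n := by
      obtain ⟨j, _⟩ := hG0
      exact j.pos
    filter_upwards [(isInvolutiveDistribution_span hG hG0).finrank,
      (hc.isInvolutiveDistribution hn).finrank, hGcomp] with x h1 h2 h3
    refine Submodule.eq_of_le_of_finrank_eq
      ((Submodule.span_singleton_le_iff_mem _ _).2 fun j hj => h3 j hj) ?_
    rw [h1, h2]
    omega
  intro i hi hin D Dhat H hch X hX
  have hchain : (∀ᶠ x in 𝓝 (0 : E n), D (i + 1) x = coordFlag T (i + 1) x) ∧
      (∀ᶠ x in 𝓝 (0 : E n), D (i + 2) x = coordFlag T (i + 2) x) ∧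
      DenselyNear fun x => Dhat (i + 1) x = coordFlag T (i + 1) x := by
    refine Nat.decreasingInduction' (m := i + 1) (n := n)
      (P := fun k => (∀ᶠ x in 𝓝 (0 : E n), D k x = coordFlag T k x) ∧
        (∀ᶠ x in 𝓝 (0 : E n), D (k + 1) x = coordFlag T (k + 1) x) ∧
        DenselyNear fun x => Dhat k x = coordFlag T k x) ?_ hin ?_
    · rintro k hkn hik ⟨h1, h2, h3⟩
      have hH : IsChoice (coordFlag T (k + 1)) (coordFlag T (k + 2)) (H (k + 1)) := by
        have h4 := hch.choice k hik hkn
        refine ⟨⟨h4.1.1, ?_⟩, h4.2.mono_eventually (h2.mono fun x h5 h6 => by rwa [← h5])⟩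
        filter_upwards [h4.1.2, h1] with x h5 h6
        rwa [← h6]
      have h7 : DenselyNear fun x => Dhat k x = coordFlag T k x := by
        refine ((hc.adSpan_coordFlag hF hfg hFcomp (by omega) hkn hH).and h3).mono ?_
        rintro x ⟨h8, h9⟩
        rw [hch.hat k hik hkn, adSpan, h9, h8]
      refine ⟨?_, h1, h7⟩
      refine (hch.distribution k hik hkn).eq_of_densely
        (hc.isInvolutiveDistribution (k := k) (by omega)) ?_
      exact ((hch.agree k hik hkn).and h7).mono fun x h => h.1.trans h.2
    · refine ⟨?_, ?_, .of_eventually ?_⟩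
      · simpa only [hch.input] using hDn
      · filter_upwards [hc.coordFlag_eq_bot] with x hx
        rw [hch.zero, hx]
      · simpa only [hch.input_hat] using hDn
  obtain ⟨h1, h2, h3⟩ := hchain
  have hX' : IsChoice (coordFlag T (i + 1)) (coordFlag T (i + 2)) X := by
    refine ⟨⟨hX.1.1, ?_⟩, hX.2.mono_eventually (h2.mono fun x h5 h6 => by rwa [← h5])⟩
    filter_upwards [hX.1.2, h1] with x h5 h6
    rwa [← h6]
  refine ⟨coordFlag T i, ?_, ?_⟩
  · rw [show n - i + 1 = n + 1 - i by omega]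
    exact hc.isInvolutiveDistribution hi
  · refine ((hc.adSpan_coordFlag hF hfg hFcomp hi hin hX').and h3).mono ?_
    rintro x ⟨h8, h9⟩
    rw [adSpan, h9, h8]

end Triangular

/-! ### Coordinates straightening a flag of involutive distributions -/

section Straightening

variable {n : ℕ}

/-- An involutive distribution of corank one in a larger distribution is cut out there by one
function, a first integral not constant along the larger distribution. -/
theorem IsInvolutiveDistribution.exists_function {d : ℕ} {D D' : E n → Submodule ℝ (E n)}
    (h : IsInvolutiveDistribution (d + 1) D) (h' : IsInvolutiveDistribution d D')
    (hle : ∀ᶠ x in 𝓝 (0 : E n), D' x ≤ D x) :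
    ∃ φ : E n → ℝ, SmoothNear φ ∧ φ 0 = 0 ∧
      ∀ᶠ x in 𝓝 (0 : E n), ∀ v, v ∈ D' x ↔ v ∈ D x ∧ fderiv ℝ φ x v = 0 := by
  obtain ⟨π, K, hK⟩ := h.exists_isAdapted
  obtain ⟨π', K', hK'⟩ := h'.exists_isAdapted
  obtain ⟨P, hP, hPD, hP0⟩ := exists_first_integrals hK' h'.involutive
  obtain ⟨w, hw, hw'⟩ : ∃ w ∈ D 0, w ∉ D' 0 := by
    by_contra! hcon
    have := Submodule.finrank_mono (show D 0 ≤ D' 0 from hcon)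
    rw [hK.finrank.self_of_nhds, hK'.finrank.self_of_nhds] at this
    omega
  obtain ⟨l, hl⟩ : ∃ l, fderiv ℝ P 0 w l ≠ 0 := by
    by_contra! hcon
    refine hw' ((hK'.mem_iff.self_of_nhds w).2 ?_)
    have h1 : fderiv ℝ P 0 w = 0 := funext hcon
    rw [hP0] at h1
    exact (sub_eq_zero.1 h1).symm
  have hφ : SmoothNear fun x => P x l - P 0 l :=
    (hP.apply l).mono fun x hx => hx.sub contDiffAt_const
  have hdφ : ∀ᶠ x in 𝓝 (0 : E n), ∀ v,
      fderiv ℝ (fun x => P x l - P 0 l) x v = fderiv ℝ P x v l := by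
    filter_upwards [hP.fderiv_apply] with x h1 v
    rw [h1, fderiv_sub_const]
  have hne : ∀ᶠ x in 𝓝 (0 : E n), fderiv ℝ (fun x => P x l - P 0 l) x (K x (π w)) ≠ 0 := by
    refine (hφ.fderiv.clm_apply (hK.isSection (π w)).1).self_of_nhds.continuousAt.eventually_ne ?_
    rwa [hdφ.self_of_nhds, (hK.mem_iff.self_of_nhds w).1 hw]
  refine ⟨fun x => P x l - P 0 l, hφ, sub_self _, ?_⟩
  filter_upwards [hdφ, hne, hPD, hK.mem, hK.finrank, hK'.finrank, hle]
    with x h1 h2 h3 h4 h5 h6 h7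
  set L := fderiv ℝ (fun x => P x l - P 0 l) x
  have hle' : D' x ≤ D x ⊓ LinearMap.ker (L : E n →ₗ[ℝ] ℝ) := fun v hv =>
    ⟨h7 hv, by
      change L v = 0
      rw [h1, h3 v hv]
      rfl⟩
  have hlt : D x ⊓ LinearMap.ker (L : E n →ₗ[ℝ] ℝ) < D x := by
    refine lt_of_le_of_ne inf_le_left fun heq => h2 ?_
    have := heq.ge (h4 (π w))
    exact this.2
  have hrank := Submodule.finrank_lt_finrank_of_lt hlt
  have heq := Submodule.eq_of_le_of_finrank_le hle' (by omega)
  intro v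
  rw [heq]
  rfl

variable {F G : E n → E n} {D Dhat : ℕ → E n → Submodule ℝ (E n)} {H : ℕ → E n → E n}

theorem IsChain.nested {i : ℕ} (h : IsChain F G i D Dhat H) (hG : SmoothNear G)
    (hG0 : ∃ j : Fin n, G 0 j ≠ 0) {k : ℕ} (hik : i ≤ k) (hk : k ≤ n) :
    ∀ᶠ x in 𝓝 (0 : E n), D (k + 1) x ≤ D k x := by
  rcases hk.eq_or_lt with rfl | hkn
  · exact Eventually.of_forall fun x => by simp [h.zero]
  · refine (h.isInvolutiveDistribution hG hG0 (by omega) (by omega)).le_of_densely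
      (h.isInvolutiveDistribution hG hG0 hik (by omega)) ?_
    refine ((h.agree k hik hkn).and (h.densely_eq_hat (k := k + 1) (by omega) hkn)).mono ?_
    rintro x ⟨h1, h2⟩
    rw [h1, h2, h.hat k hik hkn]
    exact le_sup_right

/-- The flag of distributions of a full chain is the coordinate flag of a chart. -/
theorem IsChain.exists_isChart (h : IsChain F G 1 D Dhat H) (hG : SmoothNear G)
    (hG0 : ∃ j : Fin n, G 0 j ≠ 0) :
    ∃ T S : E n → E n, IsChart T S ∧
      ∀ k, 1 ≤ k → k ≤ n + 1 → ∀ᶠ x in 𝓝 (0 : E n), D k x = coordFlag T k x := by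
  have hfun : ∀ j : Fin n, ∃ φ : E n → ℝ, SmoothNear φ ∧ φ 0 = 0 ∧
      ∀ᶠ x in 𝓝 (0 : E n), ∀ v, v ∈ D (j + 2) x ↔ v ∈ D (j + 1) x ∧ fderiv ℝ φ x v = 0 := by
    intro j
    refine IsInvolutiveDistribution.exists_function (d := n + 1 - (j + 2)) ?_
      (h.isInvolutiveDistribution hG hG0 (by omega) (by omega))
      (h.nested hG hG0 (by omega) (by omega))
    rw [show n + 1 - ((j : ℕ) + 2) + 1 = n + 1 - (j + 1) by omega]
    exact h.isInvolutiveDistribution hG hG0 (by omega) (by omega)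
  choose φ hφ hφ0 hφD using hfun
  let T : E n → E n := fun x j => φ j x
  have hT : SmoothNear T := (eventually_all.2 hφ).mono fun x hx => contDiffAt_pi.2 hx
  have hT0 : T 0 = 0 := funext hφ0
  have hflag : ∀ k, k ≤ n → ∀ᶠ x in 𝓝 (0 : E n), D (k + 1) x = coordFlag T (k + 1) x := by
    intro k
    induction k with
    | zero =>
      intro _
      filter_upwards [(h.isInvolutiveDistribution hG hG0 le_rfl (by omega)).finrank] with x hx
      rw [Submodule.eq_top_of_finrank_eq (S := D (0 + 1) x) (by simpa using hx)]
      exact (Submodule.eq_top_iff'.2 fun v j hj => absurd hj (by omega)).symm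
    | succ k ih =>
      intro hk
      filter_upwards [ih (by omega), hφD ⟨k, hk⟩] with x h1 h2
      ext v
      rw [h2, h1]
      constructor
      · rintro ⟨h3, h4⟩ j hj
        rcases (by omega : (j : ℕ) + 1 < k + 1 ∨ (j : ℕ) = k) with hj | hj
        · exact h3 j hj
        · rwa [show j = ⟨k, hk⟩ from Fin.ext hj]
      · intro h3
        exact ⟨coordFlag_anti (by omega) x h3, h3 ⟨k, hk⟩ (by simp)⟩
  have hinj : Function.Injective (fderiv ℝ T 0 : E n →ₗ[ℝ] E n) := by
    rw [← LinearMap.ker_eq_bot, Submodule.eq_bot_iff]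
    intro v hv
    have h1 : v ∈ coordFlag T (n + 1) 0 := fun j _ => by
      rw [← hT.fderiv_apply.self_of_nhds]
      exact congrFun hv j
    rwa [← (hflag n le_rfl).self_of_nhds, h.zero] at h1
  obtain ⟨S, hS, hS0, hST, hTS⟩ := exists_smooth_local_inverse (f := T) (a := 0) hT
    (LinearEquiv.ofInjectiveEndo _ hinj).toContinuousLinearEquiv (by
      ext1 v
      rfl)
  rw [hT0] at hS hTS
  refine ⟨T, S, ⟨hT, hS, hT0, hST, hTS⟩, fun k hk hkn => ?_⟩
  obtain ⟨k, rfl⟩ : ∃ k', k = k' + 1 := ⟨k - 1, by omega⟩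
  exact hflag k (by omega)

end Straightening

/-! ### From the construction to triangular forms -/

section Converse

variable {n : ℕ} {F G T S : E n → E n} {D Dhat : ℕ → E n → Submodule ℝ (E n)}
  {H : ℕ → E n → E n}

/-- A map whose `l`-th component has vanishing partial derivatives beyond the next coordinate
depends, near the origin, only on the coordinates up to the next one. -/
theorem triangular_of_partial_eq_zero {f : E n → E n} (hf : SmoothNear f)
    (h : ∀ᶠ x in 𝓝 (0 : E n), ∀ l m : Fin n, (l : ℕ) + 1 < m →
      fderiv ℝ (fun y => f y l) x (Pi.single m 1) = 0) :
    ∃ U ∈ 𝓝 (0 : E n), ∀ x ∈ U, ∀ y ∈ U, ∀ i : Fin n,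
      (∀ j : Fin n, (j : ℕ) ≤ (i : ℕ) + 1 → x j = y j) → f x i = f y i := by
  obtain ⟨r, hr, hball⟩ := Metric.eventually_nhds_iff_ball.1 (hf.and h)
  refine ⟨Metric.ball 0 r, Metric.ball_mem_nhds _ hr, fun x hx y hy i hxy => ?_⟩
  have hderiv : ∀ t ∈ Set.Icc (0 : ℝ) 1,
      HasDerivWithinAt (fun t : ℝ => f (x + t • (y - x)) i) 0 (Set.Icc 0 1) t := by
    intro t ht
    obtain ⟨h1, h2⟩ := hball _ ((convex_ball (0 : E n) r).add_smul_sub_mem hx hy ht)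
    have h3 := ((contDiffAt_pi.1 h1 i).differentiableAt (by simp)).hasFDerivAt
    have h4 : HasDerivAt (fun t : ℝ => x + t • (y - x)) (y - x) t := by
      simpa using ((hasDerivAt_id t).smul_const (y - x)).const_add x
    have h5 := (h3.comp_hasDerivAt t h4).hasDerivWithinAt (s := Set.Icc 0 1)
    convert! h5 using 1
    rw [map_eq_sum_single]
    refine (Finset.sum_eq_zero fun m _ => ?_).symm
    by_cases hm : (m : ℕ) ≤ i + 1
    · rw [Pi.sub_apply, hxy m hm, sub_self, zero_smul]
    · rw [h2 i m (by omega), smul_zero]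
  have := (convex_Icc (0 : ℝ) 1).norm_image_sub_le_of_norm_hasDerivWithin_le (C := 0) hderiv
    (by simp) (Set.left_mem_Icc.2 zero_le_one) (Set.right_mem_Icc.2 zero_le_one)
  simp only [zero_smul, add_zero, one_smul, add_sub_cancel, zero_mul, norm_le_zero_iff] at this
  exact (sub_eq_zero.1 this).symm

/-- Densely near the origin, the chosen field `H (m + 1)` has its leading component in (one-based)
position `m + 1`, and its bracket with the drift has it in position `m`. -/
theorem IsChain.choice_coordFlag (h : IsChain F G 1 D Dhat H) (hc : IsChart T S)
    (hD : ∀ k, 1 ≤ k → k ≤ n + 1 → ∀ᶠ x in 𝓝 (0 : E n), D k x = coordFlag T k x)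
    {m : ℕ} (hm : 1 ≤ m) (hmn : m < n) :
    IsSection (coordFlag T (m + 1)) (H (m + 1)) ∧
      (DenselyNear fun x => H (m + 1) x ∉ coordFlag T (m + 2) x) ∧
      (DenselyNear fun x => VectorField.lieBracket ℝ (H (m + 1)) F x ∈ coordFlag T m x) ∧
      DenselyNear fun x => VectorField.lieBracket ℝ (H (m + 1)) F x ∉ coordFlag T (m + 1) x := by
  have h1 := h.choice m hm hmn
  have hspan : DenselyNear fun x => coordFlag T m x =
      Submodule.span ℝ {VectorField.lieBracket ℝ (H (m + 1)) F x} ⊔ coordFlag T (m + 1) x := by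
    refine ((h.agree m hm hmn).and (h.densely_eq_hat (k := m + 1) (by omega) hmn)).mono_eventually
      ?_
    filter_upwards [hD m hm (by omega), hD (m + 1) (by omega) (by omega)]
    rintro x h2 h3 ⟨h4, h5⟩
    rw [← h2, h4, h.hat m hm hmn, adSpan, ← h5, h3]
  refine ⟨⟨h1.1.1, ?_⟩, ?_, ?_, ?_⟩
  · filter_upwards [h1.1.2, hD (m + 1) (by omega) (by omega)] with x h2 h3
    rwa [← h3]
  · refine h1.2.mono_eventually ?_
    filter_upwards [hD (m + 2) (by omega) (by omega)] with x h2 h3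
    rwa [← h2]
  · refine hspan.mono fun x hx => ?_
    rw [hx]
    exact Submodule.mem_sup_left (Submodule.mem_span_singleton_self _)
  · refine hspan.mono_eventually ?_
    filter_upwards [(hc.isInvolutiveDistribution hm).finrank,
      (hc.isInvolutiveDistribution (k := m + 1) (by omega)).finrank] with x h2 h3 h4 h5
    rw [sup_eq_right.2 ((Submodule.span_singleton_le_iff_mem _ _).2 h5)] at h4
    rw [h4, h3] at h2
    omega

/-- The derivative of the `j`-th component of the drift along a field of the flag which does not
move the `j`-th coordinate. -/
theorem IsChart.fderiv_drift (hc : IsChart T S) (hF : SmoothNear F) {k : ℕ} {X : E n → E n}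
    (hX : IsSection (coordFlag T k) X) (j : Fin n) (hj : (j : ℕ) + 1 < k) :
    ∀ᶠ x in 𝓝 (0 : E n), fderiv ℝ (fun y => T y j) x (VectorField.lieBracket ℝ X F x) =
      fderiv ℝ (fun y => fderiv ℝ (fun z => T z j) y (F y)) x (X x) := by
  filter_upwards [(hc.smooth.apply j).fderiv_lieBracket hX.1 hF,
    fderiv_eq_zero_of_eventually (hX.2.mono fun x hx => hx j hj)] with x h1 h2
  rw [h1, h2]
  simp

/-- The `j`-th (zero-based) component of the drift is constant along the coordinate fields
beyond the next one.  Densely these are spanned by the chosen fields, whose brackets with the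
drift do not move the `j`-th coordinate; the conclusion extends by continuity. -/
theorem IsChain.fderiv_drift_eq_zero (h : IsChain F G 1 D Dhat H) (hc : IsChart T S)
    (hF : SmoothNear F)
    (hD : ∀ k, 1 ≤ k → k ≤ n + 1 → ∀ᶠ x in 𝓝 (0 : E n), D k x = coordFlag T k x)
    (j : Fin n) (hjn : (j : ℕ) + 1 < n) :
    ∀ᶠ x in 𝓝 (0 : E n), ∀ v ∈ coordFlag T (j + 3) x,
      fderiv ℝ (fun y => fderiv ℝ (fun z => T z j) y (F y)) x v = 0 := by
  have hsm : SmoothNear fun y => fderiv ℝ (fun z => T z j) y (F y) :=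
    (hc.smooth.apply j).fderiv.clm_apply hF
  have hdense : DenselyNear fun x => ∀ v ∈ coordFlag T (j + 3) x,
      fderiv ℝ (fun y => fderiv ℝ (fun z => T z j) y (F y)) x v = 0 := by
    refine Nat.decreasingInduction' (m := (j : ℕ) + 3) (n := n + 1)
      (P := fun m => DenselyNear fun x => ∀ v ∈ coordFlag T m x,
        fderiv ℝ (fun y => fderiv ℝ (fun z => T z j) y (F y)) x v = 0) ?_ (by omega) ?_
    · intro m' hm' hjm ih
      obtain ⟨m, rfl⟩ : ∃ m, m' = m + 1 := ⟨m' - 1, by omega⟩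
      obtain ⟨h1, h2, h3, -⟩ := h.choice_coordFlag hc hD (m := m) (by omega) (by omega)
      let q : Fin n := ⟨m, by omega⟩
      -- densely the flag at level `m + 1` is spanned by `H (m + 1)` and the next level
      refine ((h2.and h3).and ih).mono_eventually ?_
      filter_upwards [hc.fderiv_drift hF h1 j (by omega), h1.2]
      rintro x h4 h5 ⟨⟨h6, h7⟩, h8⟩ v hv
      have h9 : fderiv ℝ (fun y => T y q) x (H (m + 1) x) ≠ 0 := fun h10 => h6 fun l hl => by
        rcases (by omega : (l : ℕ) + 1 < m + 1 ∨ (l : ℕ) = m) with hl | hl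
        · exact h5 l hl
        · rwa [show l = q from Fin.ext hl]
      rw [h7 j (by omega)] at h4
      set c := fderiv ℝ (fun y => T y q) x v / fderiv ℝ (fun y => T y q) x (H (m + 1) x)
      have h11 := h8 (v - c • H (m + 1) x) fun l hl => by
        rw [map_sub, map_smul, smul_eq_mul]
        rcases (by omega : (l : ℕ) + 1 < m + 1 ∨ (l : ℕ) = m) with hl | hl
        · rw [h5 l hl, hv l hl, mul_zero, sub_zero]
        · rw [show l = q from Fin.ext hl, div_mul_cancel₀ _ h9, sub_self]
      rwa [map_sub, map_smul, ← h4, smul_zero, sub_zero] at h11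
    · refine .of_eventually (hc.coordFlag_eq_bot.mono fun x hx v hv => ?_)
      rw [hx, Submodule.mem_bot] at hv
      rw [hv, map_zero]
  obtain ⟨π, K, hK⟩ :=
    (hc.isInvolutiveDistribution (k := (j : ℕ) + 3) (by omega)).exists_isAdapted
  refine hK.le_of_sections (A := fun x => LinearMap.ker
    (fderiv ℝ (fun y => fderiv ℝ (fun z => T z j) y (F y)) x : E n →ₗ[ℝ] ℝ)) fun X hX => ?_
  refine DenselyNear.eventuallyEq (hdense.mono_eventually (hX.2.mono fun x hx h => h _ hx))
    (hsm.fderiv.clm_apply hX.1).continuousAt (Eventually.of_forall fun x => continuousAt_const)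

/-- A full chain gives coordinates in which the system, without any feedback, is triangular. -/
theorem equivalent_of_conditionForSomeChoices (hF : SmoothNear F) (hG : SmoothNear G)
    (hG0 : ∃ j : Fin n, G 0 j ≠ 0) (h : ConditionForSomeChoices F G) :
    LocallyEquivalentToTriangular F G := by
  obtain ⟨D, Dhat, H, h⟩ := h
  obtain ⟨T, S, hc, hD⟩ := h.exists_isChart hG hG0
  -- the vector fields transported by the chart
  let push : (E n → E n) → E n → E n := fun X x => fderiv ℝ T (S x) (X (S x))
  have hpush : ∀ X, SmoothNear X → SmoothNear (push X) := fun X hX =>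
    (hc.smooth.fderiv.comp hc.smooth_symm hc.symm_zero).clm_apply
      (hX.comp hc.smooth_symm hc.symm_zero)
  have hpushT : ∀ X, ∀ᶠ ξ in 𝓝 (0 : E n), push X (T ξ) = fderiv ℝ T ξ (X ξ) := fun X =>
    hc.left_inv.mono fun ξ hξ => by simp only [push, hξ]
  have hcomp : ∀ X, ∀ᶠ x in 𝓝 (0 : E n), ∀ j,
      push X x j = fderiv ℝ (fun y => T y j) (S x) (X (S x)) := fun X => by
    filter_upwards [hc.symm.tendsto.eventually hc.smooth.fderiv_apply] with x hx j
    exact hx _ j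
  -- the coordinates of the chart on its coordinate fields
  have hcoord : ∀ᶠ x in 𝓝 (0 : E n), ∀ m l : Fin n,
      fderiv ℝ (fun y => T y l) x (fderiv ℝ S (T x) (Pi.single m 1)) =
        (Pi.single m (1 : ℝ) : E n) l := by
    filter_upwards [hc.smooth.fderiv_apply, hc.fderiv_fderiv_symm] with x h1 h2 m l
    rw [← h1, h2]
  have hpartial : ∀ j : Fin n, ∀ᶠ x in 𝓝 (0 : E n), ∀ w,
      fderiv ℝ (fun y => push F y j) x w =
        fderiv ℝ (fun y => fderiv ℝ (fun z => T z j) y (F y)) (S x) (fderiv ℝ S x w) := by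
    intro j
    have hsm : SmoothNear fun y => fderiv ℝ (fun z => T z j) y (F y) :=
      (hc.smooth.apply j).fderiv.clm_apply hF
    filter_upwards [(hcomp F).eventually_nhds, hc.smooth_symm.differentiableAt,
      hc.symm.tendsto.eventually hsm.differentiableAt] with x h1 h2 h3 w
    have h4 : (fun y => push F y j) =ᶠ[𝓝 x]
        (fun y => fderiv ℝ (fun z => T z j) y (F y)) ∘ S := h1.mono fun y hy => hy j
    rw [h4.fderiv_eq, (h3.hasFDerivAt.comp x h2.hasFDerivAt).fderiv]
    rfl
  have hGmem : ∀ᶠ x in 𝓝 (0 : E n), G x ∈ coordFlag T n x := by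
    have hn : 1 ≤ n := by
      obtain ⟨j, _⟩ := hG0
      exact j.pos
    filter_upwards [hD n hn (by omega)] with x hx
    rw [← hx, h.input]
    exact Submodule.mem_span_singleton_self _
  refine ⟨fun _ => 0, fun _ => 1, T, S, push F, push G, .const 0, .const 1, one_ne_zero,
    hc.smooth, hc.smooth_symm, hc.map_zero, hc.left_inv, hc.right_inv,
    ⟨hpush F hF, hpush G hG, triangular_of_partial_eq_zero (hpush F hF) ?_, ?_, ?_, ?_⟩, ?_, ?_⟩
  · refine eventually_all.2 fun l => ?_
    by_cases hl : (l : ℕ) + 1 < n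
    · filter_upwards [hpartial l, hc.symm.tendsto.eventually hcoord, hc.right_inv,
        hc.symm.tendsto.eventually (h.fderiv_drift_eq_zero hc hF hD l hl)] with x h1 h2 h3 h4 m hm
      rw [h3] at h2
      rw [h1]
      refine h4 _ fun i hi => ?_
      rw [h2, Pi.single_eq_of_ne]
      intro him
      have := congrArg Fin.val him
      omega
    · exact Eventually.of_forall fun x m hm => absurd m.2 (by omega)
  · intro j k hjk
    obtain ⟨h1, -, h2', h2⟩ := h.choice_coordFlag hc hD (m := j + 1) (by omega) (by omega)
    -- modulo fields along which the drift component is constant, `H (j + 2)` is a multiple of the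
    -- coordinate field of `k`, and the drift component is densely not constant along `H (j + 2)`
    have hne : DenselyNear fun ξ => fderiv ℝ (fun y => fderiv ℝ (fun z => T z j) y (F y)) ξ
        (fderiv ℝ S (T ξ) (Pi.single k 1)) ≠ 0 := by
      refine (h2.and h2').mono_eventually ?_
      filter_upwards [hc.fderiv_drift hF h1 j (by omega), h1.2, hcoord,
        h.fderiv_drift_eq_zero hc hF hD j (by omega)]
      rintro ξ h3 h4 h5 h6 ⟨h7, h8⟩ h9
      have h10 := h6 (H (j + 2) ξ - fderiv ℝ (fun y => T y k) ξ (H (j + 2) ξ) •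
          fderiv ℝ S (T ξ) (Pi.single k 1)) fun l hl => by
        rw [map_sub, map_smul, h5, smul_eq_mul]
        by_cases hlk : l = k
        · rw [hlk, Pi.single_eq_same, mul_one, sub_self]
        · have : (l : ℕ) ≠ k := fun h => hlk (Fin.ext h)
          rw [Pi.single_eq_of_ne hlk, mul_zero, sub_zero, h4 l (by omega)]
      rw [map_sub, map_smul, h9, smul_zero, sub_zero, ← h3] at h10
      refine h7 fun l hl => ?_
      rcases (by omega : (l : ℕ) + 1 < j + 1 ∨ (l : ℕ) = j) with hl | hl
      · exact h8 l hl
      · rwa [show l = j from Fin.ext hl]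
    refine (hc.symm.denselyNear hne).mono_eventually ?_
    filter_upwards [hpartial j, hc.right_inv] with x h3 h4 h5
    rw [h4] at h5
    rwa [h3]
  · filter_upwards [hcomp G, hc.symm.tendsto.eventually hGmem] with x h1 h2 i hi
    rw [h1]
    exact h2 i hi
  · intro i hi h0
    rw [(hcomp G).self_of_nhds, hc.symm_zero] at h0
    have h1 : G 0 ∈ coordFlag T (n + 1) 0 := fun l hl => by
      rcases (by omega : (l : ℕ) + 1 < n ∨ (l : ℕ) = i) with hl | hl
      · exact hGmem.self_of_nhds l hl
      · rwa [show l = i from Fin.ext hl]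
    rw [hc.coordFlag_eq_bot.self_of_nhds, Submodule.mem_bot] at h1
    obtain ⟨j, hj⟩ := hG0
    exact hj (by rw [h1]; rfl)
  · filter_upwards [hpushT F] with ξ hξ
    rw [hξ, zero_smul, add_zero]
  · filter_upwards [hpushT G] with ξ hξ
    rw [hξ, one_smul]

end Converse

end TriForm

theorem mainTheorem7 (n : ℕ) (F G : TriForm.E n → TriForm.E n)
    (hF : TriForm.SmoothNear F) (hF0 : F 0 = 0)
    (hG : TriForm.SmoothNear G) (hG0 : ∃ j : Fin n, G 0 j ≠ 0) :
    (TriForm.LocallyEquivalentToTriangular F G ↔ TriForm.ConditionForAllChoices F G) ∧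
    (TriForm.LocallyEquivalentToTriangular F G ↔ TriForm.ConditionForSomeChoices F G) := by
  have h12 := TriForm.conditionForAllChoices_of_equivalent hF hG hG0
  have h23 := TriForm.conditionForSomeChoices_of_forall (F := F) hG hG0
  have h31 := TriForm.equivalent_of_conditionForSomeChoices hF hG hG0
  exact ⟨⟨h12, fun h => h31 (h23 h)⟩, ⟨fun h => h23 (h12 h), h31⟩⟩
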